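/- **Free complexes are cofibrant.** *Complexes.* A *complex* (strict $\infty$-category) is a globular set $C$, that is, sets $C_n$ ($n\ge 0$) with source and target maps $s,t:C_{n+1}\rightrightarrows C_n$ such that $ss=st$ and $ts=tt$, together with units $1_x:x\to x$ in $C_{n+1}$ for $x\in C_n$ and, for $i<n$, compositions $x *_i y\in C_n$ of those $x,y\in C_n$ for which the $i$-dimensional target of $x$ equals the $i$-dimensional source of $y$. These have the usual sources and targets and satisfy associativity, the left and right unit laws, the exchange law $(x*_iy)*_j(z*_it)=(x*_jz)*_i(y*_jt)$ for $i<j$, and $1_{x*_iy}=1_x*_i1_y$. Morphisms of complexes are the maps of globular sets which preserve units and compositions. The initial complex $0$ has no cells. *Polygraphs.* Given an $n$-category $A$ and a set $S_{n+1}$ with two maps $S_{n+1}\rightrightarrows A_n$ sending each element to a pair of parallel $n$-cells (any two $0$-cells are parallel), the $(n+1)$-category freely generated by $S_{n+1}$ over $A$ has the same cells as $A$ in dimensions $\le n$; its $(n+1)$-cells are the formal compositions of elements of $S_{n+1}$ and of units on the $n$-cells of $A$, modulo the axioms above. A $0$-polygraph is a set $S_0$, and it generates the $0$-category $S_0$.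 An $(n+1)$-polygraph is an $n$-polygraph together with a set $S_{n+1}$ and two maps $S_{n+1}\rightrightarrows S^*_n$ as above to the $n$-cells of the free $n$-category generated by this $n$-polygraph, and it generates the $(n+1)$-category freely generated by $S_{n+1}$ over that $n$-category. A *polygraph* $S$ is an infinite sequence of such data, in all dimensions; the *free complex* $S^*$ it generates is the complex with $n$-cells $S^*_n$ for all $n$. *Cofibrations.* A morphism $f:A\to B$ is *left-orthogonal* to $g:C\to D$ (and $g$ *right-orthogonal* to $f$) if for all $u:A\to C$ and $v:B\to D$ with $gu=vf$ there is $h:B\to C$ with $hf=u$ and $gh=v$. For $n\ge0$, let $O_n$ be the complex generated by the $n$-globe (one cell of dimension $n$ and two cells, source and target, in each dimension $k<n$), let $\partial O_n$ be the complex generated by the same globular set without the $n$-cell, and let $\partial O_n\to O_n$ be the inclusion. A *trivial fibration* is a morphism of complexes which is right-orthogonal to $\partial O_n\to O_n$ for all $n\ge 0$. A *cofibration* is a morphism which is left-orthogonal to all trivial fibrations. A complex $C$ is *cofibrant* if $0\to C$ is a cofibration. **Proposition.** For every polygraph $S$, the free complex $S^*$ is cofibrant. -/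

import Mathlib

open CategoryTheory CategoryTheory.Limits

universe u

/-- A globular set: cells of every dimension, with sources and targets subject to the
boundary conditions. -/
structure GlobularSet where
  cell : ℕ → Type u
  src : ∀ {n : ℕ}, cell (n + 1) → cell n
  tgt : ∀ {n : ℕ}, cell (n + 1) → cell n
  src_src_eq : ∀ {n : ℕ} (x : cell (n + 2)), src (src x) = src (tgt x)
  tgt_src_eq : ∀ {n : ℕ} (x : cell (n + 2)), tgt (src x) = tgt (tgt x)

namespace GlobularSet

variable (X : GlobularSet.{u})

/-- The iterated source of an `n`-cell in dimension `i ≤ n`. -/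
def srcI {i n : ℕ} (h : i ≤ n) : X.cell n → X.cell i :=
  Nat.leRecOn (C := fun k => X.cell k → X.cell i) h (fun f x => f (X.src x)) id

/-- The iterated target of an `n`-cell in dimension `i ≤ n`. -/
def tgtI {i n : ℕ} (h : i ≤ n) : X.cell n → X.cell i :=
  Nat.leRecOn (C := fun k => X.cell k → X.cell i) h (fun f x => f (X.tgt x)) id

theorem srcI_self {n : ℕ} (h : n ≤ n) (x : X.cell n) : X.srcI h x = x :=
  congrFun (Nat.leRecOn_self (C := fun k => X.cell k → X.cell n) id) x

theorem tgtI_self {n : ℕ} (h : n ≤ n) (x : X.cell n) : X.tgtI h x = x :=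
  congrFun (Nat.leRecOn_self (C := fun k => X.cell k → X.cell n) id) x

theorem srcI_succ {i n : ℕ} (h : i ≤ n) (h' : i ≤ n + 1) (x : X.cell (n + 1)) :
    X.srcI h' x = X.srcI h (X.src x) :=
  congrFun (Nat.leRecOn_succ (C := fun k => X.cell k → X.cell i) h id) x

theorem tgtI_succ {i n : ℕ} (h : i ≤ n) (h' : i ≤ n + 1) (x : X.cell (n + 1)) :
    X.tgtI h' x = X.tgtI h (X.tgt x) :=
  congrFun (Nat.leRecOn_succ (C := fun k => X.cell k → X.cell i) h id) x

end GlobularSet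

/-- A globular set with a unit `unit x : x → x` in dimension `n + 1` on every `n`-cell `x`. -/
structure UnitalGlobularSet extends GlobularSet.{u} where
  unit : ∀ {n : ℕ}, cell n → cell (n + 1)
  src_unit : ∀ {n : ℕ} (x : cell n), src (unit x) = x
  tgt_unit : ∀ {n : ℕ} (x : cell n), tgt (unit x) = x

/-- The iterated unit on an `i`-cell in dimension `n ≥ i`. -/
def UnitalGlobularSet.unitI (X : UnitalGlobularSet.{u}) {i n : ℕ} (h : i ≤ n) :
    X.cell i → X.cell n :=
  Nat.leRecOn (C := X.cell) h X.unit

/-- A (strict) `∞`-category: a globular set with units and with, for all `i < n`, a composition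
`x *_i y` of those pairs `x`, `y` of `n`-cells such that the `i`-dimensional
target of `x` is the `i`-dimensional source of `y`, subject to associativity, the unit laws and
exchange (for compositions and for units). The hypotheses on composability
which follow from the preceding ones are there only to make the compositions meaningful. -/
structure OmegaCat extends UnitalGlobularSet.{u} where
  comp : ∀ {n : ℕ} (i : ℕ) (h : i < n) (x y : cell n), toUnitalGlobularSet.tgtI h.le x = toUnitalGlobularSet.srcI h.le y → cell n
  src_comp_top : ∀ {n : ℕ} (x y : cell (n + 1)) (h : n < n + 1)
    (hc : toUnitalGlobularSet.tgtI h.le x = toUnitalGlobularSet.srcI h.le y), src (comp n h x y hc) = src x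
  tgt_comp_top : ∀ {n : ℕ} (x y : cell (n + 1)) (h : n < n + 1)
    (hc : toUnitalGlobularSet.tgtI h.le x = toUnitalGlobularSet.srcI h.le y), tgt (comp n h x y hc) = tgt y
  src_comp : ∀ {n i : ℕ} (h : i < n) (h' : i < n + 1) (x y : cell (n + 1))
    (hc : toUnitalGlobularSet.tgtI h'.le x = toUnitalGlobularSet.srcI h'.le y) (hs : toUnitalGlobularSet.tgtI h.le (src x) = toUnitalGlobularSet.srcI h.le (src y)),
    src (comp i h' x y hc) = comp i h (src x) (src y) hs
  tgt_comp : ∀ {n i : ℕ} (h : i < n) (h' : i < n + 1) (x y : cell (n + 1))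
    (hc : toUnitalGlobularSet.tgtI h'.le x = toUnitalGlobularSet.srcI h'.le y) (ht : toUnitalGlobularSet.tgtI h.le (tgt x) = toUnitalGlobularSet.srcI h.le (tgt y)),
    tgt (comp i h' x y hc) = comp i h (tgt x) (tgt y) ht
  assoc : ∀ {n i : ℕ} (h : i < n) (x y z : cell n)
    (hxy : toUnitalGlobularSet.tgtI h.le x = toUnitalGlobularSet.srcI h.le y) (hyz : toUnitalGlobularSet.tgtI h.le y = toUnitalGlobularSet.srcI h.le z)
    (h₁ : toUnitalGlobularSet.tgtI h.le (comp i h x y hxy) = toUnitalGlobularSet.srcI h.le z)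
    (h₂ : toUnitalGlobularSet.tgtI h.le x = toUnitalGlobularSet.srcI h.le (comp i h y z hyz)),
    comp i h (comp i h x y hxy) z h₁ = comp i h x (comp i h y z hyz) h₂
  unit_comp : ∀ {n i : ℕ} (h : i < n) (x : cell n)
    (hc : toUnitalGlobularSet.tgtI h.le (toUnitalGlobularSet.unitI h.le (toUnitalGlobularSet.srcI h.le x)) = toUnitalGlobularSet.srcI h.le x),
    comp i h (toUnitalGlobularSet.unitI h.le (toUnitalGlobularSet.srcI h.le x)) x hc = x
  comp_unit : ∀ {n i : ℕ} (h : i < n) (x : cell n)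
    (hc : toUnitalGlobularSet.tgtI h.le x = toUnitalGlobularSet.srcI h.le (toUnitalGlobularSet.unitI h.le (toUnitalGlobularSet.tgtI h.le x))),
    comp i h x (toUnitalGlobularSet.unitI h.le (toUnitalGlobularSet.tgtI h.le x)) hc = x
  exchange : ∀ {n i j : ℕ} (_ : i < j) (hj : j < n) (hi : i < n) (x y z t : cell n)
    (hxy : toUnitalGlobularSet.tgtI hi.le x = toUnitalGlobularSet.srcI hi.le y) (hzt : toUnitalGlobularSet.tgtI hi.le z = toUnitalGlobularSet.srcI hi.le t)
    (hxz : toUnitalGlobularSet.tgtI hj.le x = toUnitalGlobularSet.srcI hj.le z) (hyt : toUnitalGlobularSet.tgtI hj.le y = toUnitalGlobularSet.srcI hj.le t)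
    (h₁ : toUnitalGlobularSet.tgtI hj.le (comp i hi x y hxy) = toUnitalGlobularSet.srcI hj.le (comp i hi z t hzt))
    (h₂ : toUnitalGlobularSet.tgtI hi.le (comp j hj x z hxz) = toUnitalGlobularSet.srcI hi.le (comp j hj y t hyt)),
    comp j hj (comp i hi x y hxy) (comp i hi z t hzt) h₁ =
      comp i hi (comp j hj x z hxz) (comp j hj y t hyt) h₂
  unit_exchange : ∀ {n i : ℕ} (h : i < n) (h' : i < n + 1) (x y : cell n)
    (hc : toUnitalGlobularSet.tgtI h.le x = toUnitalGlobularSet.srcI h.le y)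
    (hu : toUnitalGlobularSet.tgtI h'.le (unit x) = toUnitalGlobularSet.srcI h'.le (unit y)),
    unit (comp i h x y hc) = comp i h' (unit x) (unit y) hu

namespace OmegaCat

/-- A morphism of `∞`-categories: a morphism of globular sets which preserves units and
compositions. -/
@[ext]
structure Hom (C D : OmegaCat.{u}) where
  map : ∀ {n : ℕ}, C.cell n → D.cell n
  map_src : ∀ {n : ℕ} (x : C.cell (n + 1)), map (C.src x) = D.src (map x)
  map_tgt : ∀ {n : ℕ} (x : C.cell (n + 1)), map (C.tgt x) = D.tgt (map x)
  map_unit : ∀ {n : ℕ} (x : C.cell n), map (C.unit x) = D.unit (map x)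
  map_comp : ∀ {n i : ℕ} (h : i < n) (x y : C.cell n) (hc : C.tgtI h.le x = C.srcI h.le y)
    (hd : D.tgtI h.le (map x) = D.srcI h.le (map y)),
    map (C.comp i h x y hc) = D.comp i h (map x) (map y) hd

theorem Hom.map_srcI {C D : OmegaCat.{u}} (f : Hom C D) {i n : ℕ} (h : i ≤ n) (x : C.cell n) :
    f.map (C.srcI h x) = D.srcI h (f.map x) := by
  induction n, h using Nat.le_induction with
  | base => simp only [GlobularSet.srcI_self]
  | succ n h ih =>
    rw [C.srcI_succ h, D.srcI_succ h, ih, f.map_src]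

theorem Hom.map_tgtI {C D : OmegaCat.{u}} (f : Hom C D) {i n : ℕ} (h : i ≤ n) (x : C.cell n) :
    f.map (C.tgtI h x) = D.tgtI h (f.map x) := by
  induction n, h using Nat.le_induction with
  | base => simp only [GlobularSet.tgtI_self]
  | succ n h ih =>
    rw [C.tgtI_succ h, D.tgtI_succ h, ih, f.map_tgt]

/-- The category of `∞`-categories. -/
instance : Category.{u} OmegaCat.{u} where
  Hom := Hom
  id C := ⟨fun x => x, fun _ => rfl, fun _ => rfl, fun _ => rfl, fun _ _ _ _ _ => rfl⟩
  comp f g :=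
    { map := fun x => g.map (f.map x)
      map_src := fun x => by rw [f.map_src, g.map_src]
      map_tgt := fun x => by rw [f.map_tgt, g.map_tgt]
      map_unit := fun x => by rw [f.map_unit, g.map_unit]
      map_comp := fun {n i} h x y hc hd => by
        have e := (f.map_tgtI h.le x).symm.trans ((congrArg f.map hc).trans (f.map_srcI h.le y))
        rw [f.map_comp h x y hc e, g.map_comp h _ _ e hd] }

/-- The initial `∞`-category, with no cells. -/
def empty : OmegaCat.{u} where
  cell _ := PEmpty
  src x := x.elim
  tgt x := x.elim
  src_src_eq x := x.elim
  tgt_src_eq x := x.elim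
  unit x := x.elim
  comp _ _ x := x.elim
  src_unit x := x.elim
  tgt_unit x := x.elim
  src_comp_top x := x.elim
  tgt_comp_top x := x.elim
  src_comp _ _ x := x.elim
  tgt_comp _ _ x := x.elim
  assoc _ x := x.elim
  unit_comp _ x := x.elim
  comp_unit _ x := x.elim
  exchange _ _ _ x := x.elim
  unit_exchange _ _ x := x.elim

/-- The unique morphism from the initial `∞`-category. -/
def fromEmpty (C : OmegaCat.{u}) : empty.{u} ⟶ C where
  map x := x.elim
  map_src x := x.elim
  map_tgt x := x.elim
  map_unit x := x.elim
  map_comp _ x := x.elim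

/-- The `∞`-category with no cells is an initial object. -/
def emptyIsInitial : IsInitial empty.{u} :=
  IsInitial.ofUniqueHom fromEmpty fun _ _ => Hom.ext (by funext _ x; exact x.elim)

end OmegaCat

/-- A subset of the cells `(k, false)`, `(k, true)`, `k ∈ ℕ`, of the infinite globe, with
source and target `(k, false), (k, true)` for each cell of dimension `k + 1`, closed under taking
sources and targets. -/
structure GlobeShape where
  mem : ℕ → Bool → Prop
  mem_of_lt : ∀ {k l : ℕ} {b : Bool} (c : Bool), mem k b → l < k → mem l c

namespace GlobeShape

/-- The globe `O_n`: two cells in each dimension `k < n` and one cell in dimension `n`. -/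
def ball (n : ℕ) : GlobeShape where
  mem k b := k < n ∨ (k = n ∧ b = true)
  mem_of_lt _ h hl := by rcases h with h | h <;> left <;> omega

/-- The boundary `∂O_n`: two cells in each dimension `k < n`. -/
def sphere (n : ℕ) : GlobeShape where
  mem k _ := k < n
  mem_of_lt _ h hl := hl.trans h

/-- The `p`-cells of the `∞`-category generated by a shape: the iterated units on the cells of
the shape of dimension at most `p`. -/
@[ext]
structure Cell (A : GlobeShape) (p : ℕ) : Type u where
  dim : ℕ
  sign : Bool
  mem : A.mem dim sign
  dim_le : dim ≤ p

/-- The boundary of a cell, with the given sign. -/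
def Cell.bd {A : GlobeShape} {p : ℕ} (ε : Bool) (x : Cell.{u} A (p + 1)) : Cell.{u} A p :=
  if h : x.dim ≤ p then ⟨x.dim, x.sign, x.mem, h⟩
  else ⟨p, ε, A.mem_of_lt ε x.mem (not_le.1 h), le_rfl⟩

theorem Cell.bd_dim {A : GlobeShape} {p : ℕ} (ε : Bool) (x : Cell.{u} A (p + 1)) :
    (x.bd ε).dim = min x.dim p := by
  unfold Cell.bd; split_ifs with h <;> simp <;> omega

theorem Cell.bd_sign {A : GlobeShape} {p : ℕ} (ε : Bool) (x : Cell.{u} A (p + 1)) :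
    (x.bd ε).sign = if x.dim ≤ p then x.sign else ε := by
  unfold Cell.bd; split_ifs with h <;> simp

/-- The unit on a cell. -/
def Cell.one {A : GlobeShape} {p : ℕ} (x : Cell.{u} A p) : Cell.{u} A (p + 1) :=
  ⟨x.dim, x.sign, x.mem, x.dim_le.trans (Nat.le_succ p)⟩

/-- Composition along dimension `i`: of two composable cells, at least one is an iterated unit
on an `i`-cell, and the composite is the other one. -/
def Cell.comp {A : GlobeShape} {p : ℕ} (i : ℕ) (x y : Cell.{u} A p) : Cell.{u} A p :=
  if x.dim ≤ i then y else x

theorem Cell.eq_iff {A : GlobeShape} {p : ℕ} (x y : Cell.{u} A p) :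
    x = y ↔ x.dim = y.dim ∧ x.sign = y.sign :=
  ⟨fun h => h ▸ ⟨rfl, rfl⟩, fun h => Cell.ext h.1 h.2⟩

theorem Cell.bd_bd {A : GlobeShape} {p : ℕ} (ε : Bool) (x : Cell.{u} A (p + 2)) :
    (x.bd false).bd ε = (x.bd true).bd ε := by
  simp only [Cell.eq_iff, Cell.bd_dim, Cell.bd_sign]
  refine ⟨trivial, ?_⟩
  split_ifs <;> first | rfl | omega

variable (A : GlobeShape)

/-- The globular set with units of all cells of the `∞`-category generated by a shape. -/
abbrev cells : UnitalGlobularSet.{u} where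
  cell := Cell.{u} A
  src x := x.bd false
  tgt x := x.bd true
  src_src_eq x := Cell.bd_bd false x
  tgt_src_eq x := Cell.bd_bd true x
  unit x := x.one
  src_unit x := dif_pos x.dim_le
  tgt_unit x := dif_pos x.dim_le

theorem srcI_eq {i n : ℕ} (h : i ≤ n) (x : Cell.{u} A n) :
    ((A.cells.srcI h x : Cell.{u} A i)).dim = min x.dim i ∧
    ((A.cells.srcI h x : Cell.{u} A i)).sign = if x.dim ≤ i then x.sign else false := by
  induction n, h using Nat.le_induction with
  | base =>
    have := x.dim_le
    rw [GlobularSet.srcI_self, if_pos this, min_eq_left this]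
    exact ⟨rfl, rfl⟩
  | succ n h ih =>
    have e : (A.cells.srcI (Nat.le_succ_of_le h) x : Cell.{u} A i) =
        A.cells.srcI h (Cell.bd false x) := A.cells.srcI_succ h _ x
    have := ih (Cell.bd false x)
    rw [Cell.bd_dim, Cell.bd_sign] at this
    rw [e, this.1, this.2]
    refine ⟨by omega, ?_⟩
    split_ifs <;> first | rfl | omega

theorem tgtI_eq {i n : ℕ} (h : i ≤ n) (x : Cell.{u} A n) :
    ((A.cells.tgtI h x : Cell.{u} A i)).dim = min x.dim i ∧
    ((A.cells.tgtI h x : Cell.{u} A i)).sign = if x.dim ≤ i then x.sign else true := by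
  induction n, h using Nat.le_induction with
  | base =>
    have := x.dim_le
    rw [GlobularSet.tgtI_self, if_pos this, min_eq_left this]
    exact ⟨rfl, rfl⟩
  | succ n h ih =>
    have e : (A.cells.tgtI (Nat.le_succ_of_le h) x : Cell.{u} A i) =
        A.cells.tgtI h (Cell.bd true x) := A.cells.tgtI_succ h _ x
    have := ih (Cell.bd true x)
    rw [Cell.bd_dim, Cell.bd_sign] at this
    rw [e, this.1, this.2]
    refine ⟨by omega, ?_⟩
    split_ifs <;> first | rfl | omega

theorem unitI_eq {i n : ℕ} (h : i ≤ n) (x : Cell.{u} A i) :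
    (A.cells.unitI h x : Cell.{u} A n).dim = x.dim ∧
    (A.cells.unitI h x : Cell.{u} A n).sign = x.sign := by
  induction n, h using Nat.le_induction with
  | base =>
    have e : (A.cells.unitI le_rfl x : Cell.{u} A i) = x := Nat.leRecOn_self (C := Cell.{u} A) x
    rw [e]; exact ⟨rfl, rfl⟩
  | succ n h ih =>
    have e : (A.cells.unitI (Nat.le_succ_of_le h) x : Cell.{u} A (n + 1)) =
      Cell.one (A.cells.unitI h x) := Nat.leRecOn_succ (C := Cell.{u} A) h x
    rw [e]; exact ih

theorem composable_iff {i n : ℕ} {h : i ≤ n} {x y : Cell.{u} A n} :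
    A.cells.tgtI h x = A.cells.srcI h y ↔
      (min x.dim i = min y.dim i ∧
      (if x.dim ≤ i then x.sign else true) = if y.dim ≤ i then y.sign else false) := by
  rw [← (tgtI_eq A h x).1, ← (tgtI_eq A h x).2, ← (srcI_eq A h y).1, ← (srcI_eq A h y).2]
  exact Cell.eq_iff _ _

theorem bd_comp_top {n : ℕ} {h : n ≤ n + 1} {x y : Cell.{u} A (n + 1)}
    (hc : A.cells.tgtI h x = A.cells.srcI h y) :
    (Cell.comp n x y).bd false = x.bd false ∧ (Cell.comp n x y).bd true = y.bd true := by
  rw [composable_iff] at hc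
  have := x.dim_le; have := y.dim_le
  rw [Cell.eq_iff, Cell.eq_iff, Cell.bd_dim, Cell.bd_dim, Cell.bd_dim, Cell.bd_dim, Cell.bd_sign,
    Cell.bd_sign, Cell.bd_sign, Cell.bd_sign]
  unfold Cell.comp
  grind

theorem bd_comp {n i : ℕ} (h : i < n) (ε : Bool) (x y : Cell.{u} A (n + 1)) :
    (Cell.comp i x y).bd ε = Cell.comp i (x.bd ε) (y.bd ε) := by
  unfold Cell.comp
  rw [Cell.bd_dim]
  split_ifs <;> first | rfl | omega

theorem comp_exchange {n i j : ℕ} {hi : i ≤ n} {hj : j ≤ n} (hij : i < j)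
    {x y z t : Cell.{u} A n}
    (_ : A.cells.tgtI hi x = A.cells.srcI hi y) (hzt : A.cells.tgtI hi z = A.cells.srcI hi t)
    (hxz : A.cells.tgtI hj x = A.cells.srcI hj z) (hyt : A.cells.tgtI hj y = A.cells.srcI hj t) :
    Cell.comp j (Cell.comp i x y) (Cell.comp i z t) =
      Cell.comp i (Cell.comp j x z) (Cell.comp j y t) := by
  rw [composable_iff] at hzt hxz hyt
  have := x.dim_le; have := y.dim_le; have := z.dim_le; have := t.dim_le
  rw [Cell.eq_iff]
  unfold Cell.comp
  grind

theorem unit_comp {n i : ℕ} (h : i ≤ n) (x : Cell.{u} A n) :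
    Cell.comp i (A.cells.unitI h (A.cells.srcI h x)) x = x := by
  refine if_pos ?_
  rw [(unitI_eq A _ _).1, (srcI_eq A _ _).1]
  exact min_le_right _ _

theorem comp_unit {n i : ℕ} (h : i ≤ n) (x : Cell.{u} A n) :
    Cell.comp i x (A.cells.unitI h (A.cells.tgtI h x)) = x := by
  unfold Cell.comp
  split_ifs with hx
  · rw [Cell.eq_iff, (unitI_eq A _ _).1, (unitI_eq A _ _).2, (tgtI_eq A _ _).1,
      (tgtI_eq A _ _).2, if_pos hx]
    exact ⟨min_eq_left hx, rfl⟩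
  · rfl

theorem comp_assoc {n i : ℕ} (x y z : Cell.{u} A n) :
    Cell.comp i (Cell.comp i x y) z = Cell.comp i x (Cell.comp i y z) := by
  unfold Cell.comp
  split_ifs <;> rfl

theorem one_comp {n i : ℕ} (x y : Cell.{u} A n) :
    (Cell.comp i x y).one = Cell.comp i x.one y.one := by
  unfold Cell.comp Cell.one
  split_ifs <;> rfl

/-- The `∞`-category generated by a shape. -/
def omegaCat : OmegaCat.{u} where
  toUnitalGlobularSet := A.cells
  comp i _ x y _ := Cell.comp i x y
  src_comp_top _ _ _ hc := (bd_comp_top A hc).1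
  tgt_comp_top _ _ _ hc := (bd_comp_top A hc).2
  src_comp h _ x y _ _ := bd_comp A h false x y
  tgt_comp h _ x y _ _ := bd_comp A h true x y
  assoc _ x y z _ _ _ _ := comp_assoc A x y z
  unit_comp h x _ := unit_comp A h.le x
  comp_unit h x _ := comp_unit A h.le x
  exchange hij _ _ _ _ _ _ hxy hzt hxz hyt _ _ := comp_exchange A hij hxy hzt hxz hyt
  unit_exchange _ _ x y _ _ := one_comp A x y

/-- The inclusion of a shape in a larger one, on the cells. -/
def Cell.incl {A B : GlobeShape} (hAB : ∀ k b, A.mem k b → B.mem k b) {p : ℕ}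
    (x : Cell.{u} A p) : Cell.{u} B p :=
  ⟨x.dim, x.sign, hAB _ _ x.mem, x.dim_le⟩

theorem Cell.incl_bd {A B : GlobeShape} (hAB : ∀ k b, A.mem k b → B.mem k b) {p : ℕ}
    (ε : Bool) (x : Cell.{u} A (p + 1)) : Cell.incl hAB (x.bd ε) = (Cell.incl hAB x).bd ε := by
  rw [Cell.eq_iff, Cell.bd_dim, Cell.bd_sign]
  exact ⟨Cell.bd_dim _ x, Cell.bd_sign _ x⟩

theorem Cell.incl_comp {A B : GlobeShape} (hAB : ∀ k b, A.mem k b → B.mem k b) {p i : ℕ}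
    (x y : Cell.{u} A p) :
    Cell.incl hAB (Cell.comp i x y) = Cell.comp i (Cell.incl hAB x) (Cell.incl hAB y) := by
  unfold Cell.comp
  exact apply_ite _ _ _ _

/-- The morphism of `∞`-categories induced by an inclusion of shapes. -/
def incl {A B : GlobeShape} (hAB : ∀ k b, A.mem k b → B.mem k b) :
    A.omegaCat ⟶ (B.omegaCat : OmegaCat.{u}) where
  map x := Cell.incl hAB x
  map_src x := Cell.incl_bd hAB false x
  map_tgt x := Cell.incl_bd hAB true x
  map_unit _ := rfl
  map_comp _ x y _ _ := Cell.incl_comp hAB x y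

end GlobeShape

namespace OmegaCat

/-- The globe `O_n`, as an `∞`-category. -/
def globe (n : ℕ) : OmegaCat.{u} := (GlobeShape.ball n).omegaCat

/-- The boundary `∂O_n` of the globe, as an `∞`-category. -/
def globeBoundary (n : ℕ) : OmegaCat.{u} := (GlobeShape.sphere n).omegaCat

/-- The canonical inclusion `∂O_n → O_n`. -/
def boundaryInclusion (n : ℕ) : globeBoundary.{u} n ⟶ globe.{u} n :=
  GlobeShape.incl fun _ _ h => Or.inl h

/-- Trivial fibrations: the morphisms which are right-orthogonal to all the boundary inclusions
`∂O_n → O_n`. -/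
def trivialFibrations : MorphismProperty OmegaCat.{u} :=
  (MorphismProperty.ofHoms boundaryInclusion.{u}).rlp

/-- Cofibrations: the morphisms which are left-orthogonal to all trivial fibrations. -/
def cofibrations : MorphismProperty OmegaCat.{u} :=
  trivialFibrations.{u}.llp

/-- An `∞`-category is cofibrant if the morphism from the initial `∞`-category is a
cofibration. -/
def IsCofibrant (C : OmegaCat.{u}) : Prop :=
  cofibrations (emptyIsInitial.{u}.to C)

end OmegaCat

/-- An `n`-category, presented through its `n`-cells: for `i < n`, an `i`-cell is identified with
the iterated unit on it, so that `s i x` and `t i x` are the iterated units on the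
`i`-dimensional source and target of the `n`-cell `x`. (For `i ≥ n`, `s i` and `t i` are
conventionally the identity.) -/
structure NCat (n : ℕ) where
  cell : Type u
  s : ℕ → cell → cell
  t : ℕ → cell → cell
  s_top : ∀ {i : ℕ}, n ≤ i → ∀ x, s i x = x
  t_top : ∀ {i : ℕ}, n ≤ i → ∀ x, t i x = x
  s_s : ∀ {i j : ℕ}, i < j → ∀ x, s i (s j x) = s i x
  s_t : ∀ {i j : ℕ}, i < j → ∀ x, s i (t j x) = s i x
  t_s : ∀ {i j : ℕ}, i < j → ∀ x, t i (s j x) = t i x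
  t_t : ∀ {i j : ℕ}, i < j → ∀ x, t i (t j x) = t i x
  s_s_of_le : ∀ {i j : ℕ}, i ≤ j → ∀ x, s j (s i x) = s i x
  t_s_of_le : ∀ {i j : ℕ}, i ≤ j → ∀ x, t j (s i x) = s i x
  s_t_of_le : ∀ {i j : ℕ}, i ≤ j → ∀ x, s j (t i x) = t i x
  t_t_of_le : ∀ {i j : ℕ}, i ≤ j → ∀ x, t j (t i x) = t i x
  comp : ∀ (i : ℕ), i < n → ∀ x y : cell, t i x = s i y → cell
  s_comp_self : ∀ {i : ℕ} (h : i < n) (x y : cell) (hc : t i x = s i y),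
    s i (comp i h x y hc) = s i x
  t_comp_self : ∀ {i : ℕ} (h : i < n) (x y : cell) (hc : t i x = s i y),
    t i (comp i h x y hc) = t i y
  s_comp : ∀ {i j : ℕ} (_ : i < j) (h : i < n) (x y : cell) (hc : t i x = s i y)
    (hs : t i (s j x) = s i (s j y)), s j (comp i h x y hc) = comp i h (s j x) (s j y) hs
  t_comp : ∀ {i j : ℕ} (_ : i < j) (h : i < n) (x y : cell) (hc : t i x = s i y)
    (ht : t i (t j x) = s i (t j y)), t j (comp i h x y hc) = comp i h (t j x) (t j y) ht
  assoc : ∀ {i : ℕ} (h : i < n) (x y z : cell) (hxy : t i x = s i y) (hyz : t i y = s i z)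
    (h₁ : t i (comp i h x y hxy) = s i z) (h₂ : t i x = s i (comp i h y z hyz)),
    comp i h (comp i h x y hxy) z h₁ = comp i h x (comp i h y z hyz) h₂
  unit_comp : ∀ {i : ℕ} (h : i < n) (x : cell) (hc : t i (s i x) = s i x),
    comp i h (s i x) x hc = x
  comp_unit : ∀ {i : ℕ} (h : i < n) (x : cell) (hc : t i x = s i (t i x)),
    comp i h x (t i x) hc = x
  exchange : ∀ {i j : ℕ} (_ : i < j) (hi : i < n) (hj : j < n) (x y z w : cell)
    (hxy : t i x = s i y) (hzw : t i z = s i w) (hxz : t j x = s j z) (hyw : t j y = s j w)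
    (h₁ : t j (comp i hi x y hxy) = s j (comp i hi z w hzw))
    (h₂ : t i (comp j hj x z hxz) = s i (comp j hj y w hyw)),
    comp j hj (comp i hi x y hxy) (comp i hi z w hzw) h₁ =
      comp i hi (comp j hj x z hxz) (comp j hj y w hyw) h₂

/-- A `0`-category is a set. -/
def NCat.discrete (S : Type u) : NCat.{u} 0 where
  cell := S
  s _ x := x
  t _ x := x
  s_top _ _ := rfl
  t_top _ _ := rfl
  s_s _ _ := rfl
  s_t _ _ := rfl
  t_s _ _ := rfl
  t_t _ _ := rfl
  s_s_of_le _ _ := rfl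
  t_s_of_le _ _ := rfl
  s_t_of_le _ _ := rfl
  t_t_of_le _ _ := rfl
  comp _ h := absurd h (Nat.not_lt_zero _)
  s_comp_self h := absurd h (Nat.not_lt_zero _)
  t_comp_self h := absurd h (Nat.not_lt_zero _)
  s_comp _ h := absurd h (Nat.not_lt_zero _)
  t_comp _ h := absurd h (Nat.not_lt_zero _)
  assoc h := absurd h (Nat.not_lt_zero _)
  unit_comp h := absurd h (Nat.not_lt_zero _)
  comp_unit h := absurd h (Nat.not_lt_zero _)
  exchange _ h := absurd h (Nat.not_lt_zero _)

/-- A set of `(n + 1)`-cells to be attached to an `n`-category `A`, each with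
a source and a target which are parallel `n`-cells of `A`. -/
structure CellExt {n : ℕ} (A : NCat.{u} n) where
  gen : Type u
  src : gen → A.cell
  tgt : gen → A.cell
  s_eq : ∀ {i : ℕ}, i < n → ∀ a, A.s i (src a) = A.s i (tgt a)
  t_eq : ∀ {i : ℕ}, i < n → ∀ a, A.t i (src a) = A.t i (tgt a)

namespace CellExt

variable {n : ℕ} {A : NCat.{u} n} (E : CellExt A)

/-- Formal compositions of attached cells and of units on the `n`-cells of `A`, by source and
target: `vcomp` stands for the composition `*_n`, and `hcomp i` for the composition `*_i`,
`i < n`. -/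
inductive Term : A.cell → A.cell → Type u
  | gen (a : E.gen) : Term (E.src a) (E.tgt a)
  | unit (x : A.cell) : Term x x
  | vcomp {x y y' z : A.cell} (u : Term x y) (v : Term y' z) (h : y = y') : Term x z
  | hcomp (i : ℕ) (hi : i < n) {x x' y y' : A.cell} (u : Term x x') (v : Term y y')
      (h : A.t i x = A.s i y) (h' : A.t i x' = A.s i y') :
      Term (A.comp i hi x y h) (A.comp i hi x' y' h')

open Term in
/-- The congruence on formal compositions generated by associativity, the unit laws and
exchange. -/
inductive Rel : ∀ {x y x' y' : A.cell}, E.Term x y → E.Term x' y' → Prop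
  | refl {x y : A.cell} (u : E.Term x y) : Rel u u
  | symm {x y x' y' : A.cell} {u : E.Term x y} {v : E.Term x' y'} : Rel u v → Rel v u
  | trans {x y x' y' x'' y'' : A.cell} {u : E.Term x y} {v : E.Term x' y'} {w : E.Term x'' y''} :
      Rel u v → Rel v w → Rel u w
  | vcomp_congr {x y z w x' y' z' w' : A.cell} {u : E.Term x y} {v : E.Term z w}
      {u' : E.Term x' y'} {v' : E.Term z' w'} (h : y = z) (h' : y' = z') :
      Rel u u' → Rel v v' → Rel (vcomp u v h) (vcomp u' v' h')
  | hcomp_congr {i : ℕ} (hi : i < n) {x y z w x' y' z' w' : A.cell} {u : E.Term x y}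
      {v : E.Term z w} {u' : E.Term x' y'} {v' : E.Term z' w'}
      (h₁ : A.t i x = A.s i z) (h₂ : A.t i y = A.s i w)
      (h₁' : A.t i x' = A.s i z') (h₂' : A.t i y' = A.s i w') :
      Rel u u' → Rel v v' → Rel (hcomp i hi u v h₁ h₂) (hcomp i hi u' v' h₁' h₂')
  | vcomp_assoc {x y y' z z' w : A.cell} (u : E.Term x y) (v : E.Term y' z) (r : E.Term z' w)
      (h : y = y') (h' : z = z') :
      Rel (vcomp (vcomp u v h) r h') (vcomp u (vcomp v r h') h)
  | hcomp_assoc {i : ℕ} (hi : i < n) {x x' y y' z z' : A.cell} (u : E.Term x x')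
      (v : E.Term y y') (r : E.Term z z')
      (h₁ : A.t i x = A.s i y) (h₁' : A.t i x' = A.s i y')
      (h₂ : A.t i y = A.s i z) (h₂' : A.t i y' = A.s i z')
      (h₃ : A.t i (A.comp i hi x y h₁) = A.s i z)
      (h₃' : A.t i (A.comp i hi x' y' h₁') = A.s i z')
      (h₄ : A.t i x = A.s i (A.comp i hi y z h₂))
      (h₄' : A.t i x' = A.s i (A.comp i hi y' z' h₂')) :
      Rel (hcomp i hi (hcomp i hi u v h₁ h₁') r h₃ h₃')
        (hcomp i hi u (hcomp i hi v r h₂ h₂') h₄ h₄')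
  | unit_vcomp {x y z : A.cell} (u : E.Term x y) (h : z = x) : Rel (vcomp (unit z) u h) u
  | vcomp_unit {x y z : A.cell} (u : E.Term x y) (h : y = z) : Rel (vcomp u (unit z) h) u
  | unit_hcomp {i : ℕ} (hi : i < n) {x y : A.cell} (u : E.Term x y)
      (h : A.t i (A.s i x) = A.s i x) (h' : A.t i (A.s i x) = A.s i y) :
      Rel (hcomp i hi (unit (A.s i x)) u h h') u
  | hcomp_unit {i : ℕ} (hi : i < n) {x y : A.cell} (u : E.Term x y)
      (h : A.t i x = A.s i (A.t i y)) (h' : A.t i y = A.s i (A.t i y)) :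
      Rel (hcomp i hi u (unit (A.t i y)) h h') u
  | hcomp_vcomp {i : ℕ} (hi : i < n) {x x' y y' z z' w w' : A.cell}
      (u : E.Term x x') (v : E.Term y y') (r : E.Term z z') (q : E.Term w w')
      (h₁ : A.t i x = A.s i y) (h₁' : A.t i x' = A.s i y')
      (h₂ : A.t i z = A.s i w) (h₂' : A.t i z' = A.s i w')
      (h : A.comp i hi x' y' h₁' = A.comp i hi z w h₂)
      (hur : x' = z) (hvq : y' = w) :
      Rel (vcomp (hcomp i hi u v h₁ h₁') (hcomp i hi r q h₂ h₂') h)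
        (hcomp i hi (vcomp u r hur) (vcomp v q hvq) h₁ h₂')
  | hcomp_hcomp {i j : ℕ} (hij : i < j) (hi : i < n) (hj : j < n) {x x' y y' z z' w w' : A.cell}
      (u : E.Term x x') (v : E.Term y y') (r : E.Term z z') (q : E.Term w w')
      (h₁ : A.t i x = A.s i y) (h₁' : A.t i x' = A.s i y')
      (h₂ : A.t i z = A.s i w) (h₂' : A.t i z' = A.s i w')
      (h₃ : A.t j x = A.s j z) (h₃' : A.t j x' = A.s j z')
      (h₄ : A.t j y = A.s j w) (h₄' : A.t j y' = A.s j w')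
      (h₅ : A.t j (A.comp i hi x y h₁) = A.s j (A.comp i hi z w h₂))
      (h₅' : A.t j (A.comp i hi x' y' h₁') = A.s j (A.comp i hi z' w' h₂'))
      (h₆ : A.t i (A.comp j hj x z h₃) = A.s i (A.comp j hj y w h₄))
      (h₆' : A.t i (A.comp j hj x' z' h₃') = A.s i (A.comp j hj y' w' h₄')) :
      Rel (hcomp j hj (hcomp i hi u v h₁ h₁') (hcomp i hi r q h₂ h₂') h₅ h₅')
        (hcomp i hi (hcomp j hj u r h₃ h₃') (hcomp j hj v q h₄ h₄') h₆ h₆')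
  | unit_exchange {i : ℕ} (hi : i < n) (x y : A.cell) (h h' : A.t i x = A.s i y) :
      Rel (hcomp i hi (unit x) (unit y) h h') (unit (A.comp i hi x y h))

variable {E}

theorem _root_.NCat.t_s_self {n : ℕ} (A : NCat.{u} n) (i : ℕ) (x : A.cell) :
    A.t i (A.s i x) = A.s i x := A.t_s_of_le le_rfl x

theorem _root_.NCat.s_t_self {n : ℕ} (A : NCat.{u} n) (i : ℕ) (x : A.cell) :
    A.s i (A.t i x) = A.t i x := A.s_t_of_le le_rfl x

theorem _root_.NCat.comp_congr {n : ℕ} (A : NCat.{u} n) {i : ℕ} (hi : i < n)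
    {x y x' y' : A.cell} (hx : x = x') (hy : y = y') (h : A.t i x = A.s i y)
    (h' : A.t i x' = A.s i y') : A.comp i hi x y h = A.comp i hi x' y' h' := by
  subst hx hy; rfl

theorem _root_.NCat.s_comp_lt {n : ℕ} (A : NCat.{u} n) {i j : ℕ} (hi : i < n) (hj : j ≤ i)
    {x y : A.cell} (h : A.t i x = A.s i y) : A.s j (A.comp i hi x y h) = A.s j x := by
  rcases hj.eq_or_lt with rfl | hj
  · exact A.s_comp_self _ _ _ _
  · rw [← A.s_s hj, A.s_comp_self, A.s_s hj]

theorem _root_.NCat.t_comp_lt {n : ℕ} (A : NCat.{u} n) {i j : ℕ} (hi : i < n) (hj : j ≤ i)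
    {x y : A.cell} (h : A.t i x = A.s i y) : A.t j (A.comp i hi x y h) = A.t j y := by
  rcases hj.eq_or_lt with rfl | hj
  · exact A.t_comp_self _ _ _ _
  · rw [← A.t_t hj, A.t_comp_self, A.t_t hj]

theorem Term.parallel {x y : A.cell} (u : E.Term x y) :
    ∀ {i : ℕ}, i < n → A.s i x = A.s i y ∧ A.t i x = A.t i y := by
  induction u with
  | gen a => exact fun hi => ⟨E.s_eq hi a, E.t_eq hi a⟩
  | unit x => exact fun _ => ⟨rfl, rfl⟩
  | vcomp u v h ihu ihv =>
    intro i hi; subst h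
    exact ⟨(ihu hi).1.trans (ihv hi).1, (ihu hi).2.trans (ihv hi).2⟩
  | hcomp j hj u v h h' ihu ihv =>
    intro i hi
    rcases le_or_gt i j with hij | hij
    · rw [A.s_comp_lt hj hij, A.s_comp_lt hj hij, A.t_comp_lt hj hij, A.t_comp_lt hj hij]
      exact ⟨(ihu hi).1, (ihv hi).2⟩
    · rw [A.s_comp hij hj _ _ _ (by rw [A.t_s hij, A.s_s hij, h]),
        A.s_comp hij hj _ _ _ (by rw [A.t_s hij, A.s_s hij, h']),
        A.t_comp hij hj _ _ _ (by rw [A.t_t hij, A.s_t hij, h]),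
        A.t_comp hij hj _ _ _ (by rw [A.t_t hij, A.s_t hij, h'])]
      exact ⟨A.comp_congr hj (ihu hi).1 (ihv hi).1 _ _, A.comp_congr hj (ihu hi).2 (ihv hi).2 _ _⟩

theorem Rel.sound {x y x' y' : A.cell} {u : E.Term x y} {v : E.Term x' y'} (h : E.Rel u v) :
    x = x' ∧ y = y' := by
  induction h with
  | refl u => exact ⟨rfl, rfl⟩
  | symm _ ih => exact ⟨ih.1.symm, ih.2.symm⟩
  | trans _ _ ih₁ ih₂ => exact ⟨ih₁.1.trans ih₂.1, ih₁.2.trans ih₂.2⟩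
  | vcomp_congr _ _ _ _ ih₁ ih₂ => exact ⟨ih₁.1, ih₂.2⟩
  | hcomp_congr hi _ _ _ _ _ _ ih₁ ih₂ =>
    exact ⟨A.comp_congr hi ih₁.1 ih₂.1 _ _, A.comp_congr hi ih₁.2 ih₂.2 _ _⟩
  | vcomp_assoc => exact ⟨rfl, rfl⟩
  | hcomp_assoc hi _ _ _ => exact ⟨A.assoc hi _ _ _ _ _ _ _, A.assoc hi _ _ _ _ _ _ _⟩
  | unit_vcomp u h => exact ⟨h, rfl⟩
  | vcomp_unit u h => exact ⟨rfl, h.symm⟩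
  | @unit_hcomp i hi x y u h h' =>
    refine ⟨A.unit_comp hi x _, ?_⟩
    have e := (u.parallel hi).1
    rw [A.comp_congr hi e rfl h' (A.t_s_self i y)]
    exact A.unit_comp hi y _
  | @hcomp_unit i hi x y u h h' =>
    refine ⟨?_, A.comp_unit hi y _⟩
    have e := (u.parallel hi).2
    rw [A.comp_congr hi rfl e.symm h (A.s_t_self i x).symm]
    exact A.comp_unit hi x _
  | hcomp_vcomp => exact ⟨rfl, rfl⟩
  | hcomp_hcomp hij hi hj =>
    exact ⟨A.exchange hij hi hj _ _ _ _ _ _ _ _ _ _, A.exchange hij hi hj _ _ _ _ _ _ _ _ _ _⟩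
  | unit_exchange => exact ⟨rfl, rfl⟩

variable (E) in
/-- A formal composition with its source and target. -/
structure Packed : Type u where
  src : A.cell
  tgt : A.cell
  term : E.Term src tgt

variable (E) in
/-- Formal compositions up to the congruence. -/
instance packedSetoid : Setoid E.Packed where
  r u v := E.Rel u.term v.term
  iseqv := ⟨fun _ => Rel.refl _, Rel.symm, Rel.trans⟩

variable (E) in
/-- The `(n + 1)`-cells of the free `(n + 1)`-category generated by `E` over `A`. -/
def Cell : Type u := Quotient (packedSetoid E)

namespace Cell

/-- The cell represented by a formal composition. -/
def mk {x y : A.cell} (u : E.Term x y) : E.Cell := Quotient.mk _ ⟨x, y, u⟩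

theorem mk_eq {x y x' y' : A.cell} {u : E.Term x y} {v : E.Term x' y'} (h : E.Rel u v) :
    mk u = mk v := Quotient.sound h

/-- The source of a cell. -/
def src (c : E.Cell) : A.cell := Quotient.lift Packed.src (fun _ _ h => (Rel.sound h).1) c

/-- The target of a cell. -/
def tgt (c : E.Cell) : A.cell := Quotient.lift Packed.tgt (fun _ _ h => (Rel.sound h).2) c

theorem exists_mk (c : E.Cell) : ∃ (x y : A.cell) (u : E.Term x y), c = mk u :=
  Quotient.inductionOn c fun p => ⟨p.src, p.tgt, p.term, rfl⟩

/-- The unit on an `n`-cell. -/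
def unit (x : A.cell) : E.Cell := mk (Term.unit x)

theorem parallel (c : E.Cell) {i : ℕ} (hi : i < n) :
    A.s i c.src = A.s i c.tgt ∧ A.t i c.src = A.t i c.tgt := by
  obtain ⟨x, y, u, rfl⟩ := exists_mk c
  exact u.parallel hi

theorem out_src (c : E.Cell) : (Quotient.out c).src = c.src :=
  congrArg src (Quotient.out_eq c)

theorem out_tgt (c : E.Cell) : (Quotient.out c).tgt = c.tgt :=
  congrArg tgt (Quotient.out_eq c)

/-- The composition `*_n`. -/
noncomputable def vcomp (a b : E.Cell) (h : a.tgt = b.src) : E.Cell :=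
  mk (Term.vcomp (Quotient.out a).term (Quotient.out b).term
    ((out_tgt a).trans (h.trans (out_src b).symm)))

theorem hcomp_aux {i : ℕ} (hi : i < n) {a b : E.Cell} (h : A.t i a.src = A.s i b.src) :
    A.t i a.tgt = A.s i b.tgt := by
  rw [← (a.parallel hi).2, ← (b.parallel hi).1, h]

/-- The composition `*_i`, for `i < n`. -/
noncomputable def hcomp (i : ℕ) (hi : i < n) (a b : E.Cell)
    (h : A.t i a.src = A.s i b.src) : E.Cell :=
  mk (Term.hcomp i hi (Quotient.out a).term (Quotient.out b).term
    (by rw [out_src, out_src, h]) (by rw [out_tgt, out_tgt, hcomp_aux hi h]))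

theorem vcomp_mk {x y z w : A.cell} (u : E.Term x y) (v : E.Term z w) (h : y = z) :
    vcomp (mk u) (mk v) h = mk (Term.vcomp u v h) :=
  mk_eq (Rel.vcomp_congr _ _ (Quotient.mk_out (s := packedSetoid E) ⟨x, y, u⟩)
    (Quotient.mk_out (s := packedSetoid E) ⟨z, w, v⟩))

theorem hcomp_mk {i : ℕ} (hi : i < n) {x y z w : A.cell} (u : E.Term x y) (v : E.Term z w)
    (h : A.t i x = A.s i z) (h' : A.t i y = A.s i w) :
    hcomp i hi (mk u) (mk v) h = mk (Term.hcomp i hi u v h h') :=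
  mk_eq (Rel.hcomp_congr hi _ _ _ _ (Quotient.mk_out (s := packedSetoid E) ⟨x, y, u⟩)
    (Quotient.mk_out (s := packedSetoid E) ⟨z, w, v⟩))

theorem src_vcomp (a b : E.Cell) (h : a.tgt = b.src) : (vcomp a b h).src = a.src := out_src a

theorem tgt_vcomp (a b : E.Cell) (h : a.tgt = b.src) : (vcomp a b h).tgt = b.tgt := out_tgt b

theorem src_hcomp {i : ℕ} (hi : i < n) (a b : E.Cell) (h : A.t i a.src = A.s i b.src) :
    (hcomp i hi a b h).src = A.comp i hi a.src b.src h :=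
  A.comp_congr hi (out_src a) (out_src b) _ _

theorem tgt_hcomp {i : ℕ} (hi : i < n) (a b : E.Cell) (h : A.t i a.src = A.s i b.src) :
    (hcomp i hi a b h).tgt = A.comp i hi a.tgt b.tgt (hcomp_aux hi h) :=
  A.comp_congr hi (out_tgt a) (out_tgt b) _ _

theorem vcomp_congr {a b a' b' : E.Cell} (ha : a = a') (hb : b = b') (h : a.tgt = b.src)
    (h' : a'.tgt = b'.src) : vcomp a b h = vcomp a' b' h' := by
  subst ha hb; rfl

theorem hcomp_congr {i : ℕ} (hi : i < n) {a b a' b' : E.Cell} (ha : a = a') (hb : b = b')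
    (h : A.t i a.src = A.s i b.src) (h' : A.t i a'.src = A.s i b'.src) :
    hcomp i hi a b h = hcomp i hi a' b' h' := by
  subst ha hb; rfl

theorem vcomp_assoc (a b c : E.Cell) (h : a.tgt = b.src) (h' : b.tgt = c.src)
    (h₁ : (vcomp a b h).tgt = c.src) (h₂ : a.tgt = (vcomp b c h').src) :
    vcomp (vcomp a b h) c h₁ = vcomp a (vcomp b c h') h₂ := by
  obtain ⟨x, x', u, rfl⟩ := exists_mk a
  obtain ⟨y, y', v, rfl⟩ := exists_mk b
  obtain ⟨z, z', w, rfl⟩ := exists_mk c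
  exact ((vcomp_congr (vcomp_mk u v h) rfl h₁ h').trans (vcomp_mk _ _ h')).trans
    ((mk_eq (Rel.vcomp_assoc u v w h h')).trans
      ((vcomp_congr rfl (vcomp_mk v w h') h₂ h).trans (vcomp_mk _ _ h)).symm)

theorem hcomp_assoc {i : ℕ} (hi : i < n) (a b c : E.Cell) (h : A.t i a.src = A.s i b.src)
    (h' : A.t i b.src = A.s i c.src) (h₁ : A.t i (hcomp i hi a b h).src = A.s i c.src)
    (h₂ : A.t i a.src = A.s i (hcomp i hi b c h').src) :
    hcomp i hi (hcomp i hi a b h) c h₁ = hcomp i hi a (hcomp i hi b c h') h₂ := by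
  have k := hcomp_aux hi h
  have k' := hcomp_aux hi h'
  obtain ⟨x, x', u, rfl⟩ := exists_mk a
  obtain ⟨y, y', v, rfl⟩ := exists_mk b
  obtain ⟨z, z', w, rfl⟩ := exists_mk c
  have e₁ := hcomp_mk hi u v h k
  have e₂ := hcomp_mk hi v w h' k'
  have l₁ := h₁
  have l₂ := h₂
  rw [e₁] at l₁
  rw [e₂] at l₂
  exact ((hcomp_congr hi e₁ rfl h₁ l₁).trans (hcomp_mk hi _ _ l₁ (hcomp_aux hi l₁))).trans
    ((mk_eq (Rel.hcomp_assoc hi u v w h k h' k' _ _ _ _)).trans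
      ((hcomp_congr hi rfl e₂ h₂ l₂).trans (hcomp_mk hi _ _ l₂ (hcomp_aux hi l₂))).symm)

theorem unit_vcomp (a : E.Cell) (x : A.cell) (h : x = a.src) : vcomp (unit x) a h = a := by
  obtain ⟨x, x', u, rfl⟩ := exists_mk a
  exact (vcomp_mk _ _ h).trans (mk_eq (Rel.unit_vcomp u h))

theorem vcomp_unit (a : E.Cell) (x : A.cell) (h : a.tgt = x) : vcomp a (unit x) h = a := by
  obtain ⟨x, x', u, rfl⟩ := exists_mk a
  exact (vcomp_mk _ _ h).trans (mk_eq (Rel.vcomp_unit u h))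

theorem unit_hcomp {i : ℕ} (hi : i < n) (a : E.Cell)
    (h : A.t i (unit (E := E) (A.s i a.src)).src = A.s i a.src) :
    hcomp i hi (unit (A.s i a.src)) a h = a := by
  have k := hcomp_aux hi h
  obtain ⟨x, x', u, rfl⟩ := exists_mk a
  exact (hcomp_mk hi _ _ h k).trans (mk_eq (Rel.unit_hcomp hi u h k))

theorem hcomp_unit {i : ℕ} (hi : i < n) (a : E.Cell)
    (h : A.t i a.src = A.s i (unit (E := E) (A.t i a.tgt)).src) :
    hcomp i hi a (unit (A.t i a.tgt)) h = a := by
  have k := hcomp_aux hi h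
  obtain ⟨x, x', u, rfl⟩ := exists_mk a
  exact (hcomp_mk hi _ _ h k).trans (mk_eq (Rel.hcomp_unit hi u h k))

theorem hcomp_vcomp {i : ℕ} (hi : i < n) (a b c d : E.Cell) (hab : A.t i a.src = A.s i b.src)
    (hcd : A.t i c.src = A.s i d.src) (hac : a.tgt = c.src) (hbd : b.tgt = d.src)
    (h₁ : (hcomp i hi a b hab).tgt = (hcomp i hi c d hcd).src)
    (h₂ : A.t i (vcomp a c hac).src = A.s i (vcomp b d hbd).src) :
    vcomp (hcomp i hi a b hab) (hcomp i hi c d hcd) h₁ =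
      hcomp i hi (vcomp a c hac) (vcomp b d hbd) h₂ := by
  have kab := hcomp_aux hi hab
  have kcd := hcomp_aux hi hcd
  obtain ⟨x, x', u, rfl⟩ := exists_mk a
  obtain ⟨y, y', v, rfl⟩ := exists_mk b
  obtain ⟨z, z', r, rfl⟩ := exists_mk c
  obtain ⟨w, w', q, rfl⟩ := exists_mk d
  have e₁ := hcomp_mk hi u v hab kab
  have e₂ := hcomp_mk hi r q hcd kcd
  have l₁ := h₁
  rw [e₁, e₂] at l₁
  exact ((vcomp_congr e₁ e₂ h₁ l₁).trans (vcomp_mk _ _ l₁)).trans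
    ((mk_eq (Rel.hcomp_vcomp hi u v r q hab kab hcd kcd l₁ hac hbd)).trans
      ((hcomp_congr hi (vcomp_mk u r hac) (vcomp_mk v q hbd) h₂ hab).trans
        (hcomp_mk hi _ _ hab kcd)).symm)

theorem hcomp_hcomp {i j : ℕ} (hij : i < j) (hi : i < n) (hj : j < n) (a b c d : E.Cell)
    (hab : A.t i a.src = A.s i b.src) (hcd : A.t i c.src = A.s i d.src)
    (hac : A.t j a.src = A.s j c.src) (hbd : A.t j b.src = A.s j d.src)
    (h₁ : A.t j (hcomp i hi a b hab).src = A.s j (hcomp i hi c d hcd).src)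
    (h₂ : A.t i (hcomp j hj a c hac).src = A.s i (hcomp j hj b d hbd).src) :
    hcomp j hj (hcomp i hi a b hab) (hcomp i hi c d hcd) h₁ =
      hcomp i hi (hcomp j hj a c hac) (hcomp j hj b d hbd) h₂ := by
  have kab := hcomp_aux hi hab
  have kcd := hcomp_aux hi hcd
  have kac := hcomp_aux hj hac
  have kbd := hcomp_aux hj hbd
  obtain ⟨x, x', u, rfl⟩ := exists_mk a
  obtain ⟨y, y', v, rfl⟩ := exists_mk b
  obtain ⟨z, z', r, rfl⟩ := exists_mk c
  obtain ⟨w, w', q, rfl⟩ := exists_mk d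
  have e₁ := hcomp_mk hi u v hab kab
  have e₂ := hcomp_mk hi r q hcd kcd
  have e₃ := hcomp_mk hj u r hac kac
  have e₄ := hcomp_mk hj v q hbd kbd
  have l₁ := h₁
  have l₂ := h₂
  rw [e₁, e₂] at l₁
  rw [e₃, e₄] at l₂
  exact ((hcomp_congr hj e₁ e₂ h₁ l₁).trans (hcomp_mk hj _ _ l₁ (hcomp_aux hj l₁))).trans
    ((mk_eq (Rel.hcomp_hcomp hij hi hj u v r q hab kab hcd kcd hac kac hbd kbd _ _ _ _)).trans
      ((hcomp_congr hi e₃ e₄ h₂ l₂).trans (hcomp_mk hi _ _ l₂ (hcomp_aux hi l₂))).symm)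

theorem unit_exchange {i : ℕ} (hi : i < n) (x y : A.cell) (h : A.t i x = A.s i y) :
    hcomp i hi (unit (E := E) x) (unit y) h = unit (A.comp i hi x y h) :=
  (hcomp_mk hi _ _ h h).trans (mk_eq (Rel.unit_exchange hi x y h h))

/-- The (unit on the) `i`-dimensional source. -/
def s (i : ℕ) (c : E.Cell) : E.Cell := if i ≤ n then unit (A.s i c.src) else c

/-- The (unit on the) `i`-dimensional target. -/
def t (i : ℕ) (c : E.Cell) : E.Cell := if i ≤ n then unit (A.t i c.tgt) else c

theorem unit_inj {x y : A.cell} (h : (unit x : E.Cell) = unit y) : x = y := congrArg src h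

theorem s_of_le {i : ℕ} (h : i ≤ n) (c : E.Cell) : s i c = unit (A.s i c.src) := if_pos h

theorem t_of_le {i : ℕ} (h : i ≤ n) (c : E.Cell) : t i c = unit (A.t i c.tgt) := if_pos h

theorem s_of_lt {i : ℕ} (h : n < i) (c : E.Cell) : s i c = c := if_neg (not_le.2 h)

theorem t_of_lt {i : ℕ} (h : n < i) (c : E.Cell) : t i c = c := if_neg (not_le.2 h)

theorem composable_iff {i : ℕ} (hi : i < n) {a b : E.Cell} :
    t i a = s i b ↔ A.t i a.src = A.s i b.src := by
  rw [t_of_le hi.le, s_of_le hi.le, (a.parallel hi).2]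
  exact ⟨unit_inj, congrArg _⟩

theorem composable_top_iff {a b : E.Cell} : t n a = s n b ↔ a.tgt = b.src := by
  rw [t_of_le le_rfl, s_of_le le_rfl, A.t_top le_rfl, A.s_top le_rfl]
  exact ⟨unit_inj, congrArg _⟩

/-- The composition `*_i`, for `i ≤ n`. -/
noncomputable def comp (i : ℕ) (hi : i < n + 1) (a b : E.Cell) (h : t i a = s i b) : E.Cell :=
  if hn : i < n then hcomp i hn a b ((composable_iff hn).1 h)
  else vcomp a b (composable_top_iff.1 (by
    obtain rfl : i = n := by omega
    exact h))

theorem comp_of_lt {i : ℕ} (hi : i < n) (hi' : i < n + 1) {a b : E.Cell} (h : t i a = s i b) :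
    comp i hi' a b h = hcomp i hi a b ((composable_iff hi).1 h) := dif_pos hi

theorem comp_top (hn : n < n + 1) {a b : E.Cell} (h : t n a = s n b) :
    comp n hn a b h = vcomp a b (composable_top_iff.1 h) := dif_neg (lt_irrefl n)

theorem src_unit (x : A.cell) : (unit x : E.Cell).src = x := rfl

theorem tgt_unit (x : A.cell) : (unit x : E.Cell).tgt = x := rfl

end Cell

end CellExt

open CellExt.Cell in
/-- The free `(n + 1)`-category generated by attaching the cells of `E` to the `n`-category `A`. -/
noncomputable def CellExt.free {n : ℕ} {A : NCat.{u} n} (E : CellExt A) : NCat.{u} (n + 1) where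
  cell := E.Cell
  s := s
  t := t
  s_top h x := s_of_lt h x
  t_top h x := t_of_lt h x
  s_s {i j} h x := by
    rcases le_or_gt j n with hj | hj
    · rw [s_of_le hj, s_of_le (h.le.trans hj), s_of_le (h.le.trans hj), src_unit, A.s_s h]
    · rw [s_of_lt hj]
  s_t {i j} h x := by
    rcases le_or_gt j n with hj | hj
    · rw [t_of_le hj, s_of_le (h.le.trans hj), s_of_le (h.le.trans hj), src_unit, A.s_t h,
        (x.parallel (h.trans_le hj)).1]
    · rw [t_of_lt hj]
  t_s {i j} h x := by
    rcases le_or_gt j n with hj | hj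
    · rw [s_of_le hj, t_of_le (h.le.trans hj), t_of_le (h.le.trans hj), tgt_unit, A.t_s h,
        (x.parallel (h.trans_le hj)).2]
    · rw [s_of_lt hj]
  t_t {i j} h x := by
    rcases le_or_gt j n with hj | hj
    · rw [t_of_le hj, t_of_le (h.le.trans hj), t_of_le (h.le.trans hj), tgt_unit, A.t_t h]
    · rw [t_of_lt hj]
  s_s_of_le {i j} h x := by
    rcases le_or_gt j n with hj | hj
    · rw [s_of_le hj, s_of_le (h.trans hj), src_unit, A.s_s_of_le h]
    · rw [s_of_lt hj]
  t_s_of_le {i j} h x := by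
    rcases le_or_gt j n with hj | hj
    · rw [t_of_le hj, s_of_le (h.trans hj), tgt_unit, A.t_s_of_le h]
    · rw [t_of_lt hj]
  s_t_of_le {i j} h x := by
    rcases le_or_gt j n with hj | hj
    · rw [s_of_le hj, t_of_le (h.trans hj), src_unit, A.s_t_of_le h]
    · rw [s_of_lt hj]
  t_t_of_le {i j} h x := by
    rcases le_or_gt j n with hj | hj
    · rw [t_of_le hj, t_of_le (h.trans hj), tgt_unit, A.t_t_of_le h]
    · rw [t_of_lt hj]
  comp := comp
  s_comp_self {i} h x y hc := by
    rcases (Nat.lt_succ_iff.1 h).eq_or_lt with rfl | hi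
    · rw [comp_top, s_of_le le_rfl, src_vcomp, s_of_le le_rfl]
    · rw [comp_of_lt hi, s_of_le hi.le, src_hcomp, A.s_comp_self, s_of_le hi.le]
  t_comp_self {i} h x y hc := by
    rcases (Nat.lt_succ_iff.1 h).eq_or_lt with rfl | hi
    · rw [comp_top, t_of_le le_rfl, tgt_vcomp, t_of_le le_rfl]
    · rw [comp_of_lt hi, t_of_le hi.le, tgt_hcomp, A.t_comp_self, t_of_le hi.le]
  s_comp {i j} hij h x y hc hs := by
    rcases le_or_gt j n with hj | hj
    · have hi : i < n := hij.trans_le hj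
      have hx : A.t i (A.s j x.src) = A.s i (A.s j y.src) := by
        rw [A.t_s hij, A.s_s hij, (composable_iff hi).1 hc]
      rw [comp_of_lt hi, comp_of_lt hi, hcomp_congr hi (s_of_le hj x) (s_of_le hj y) _ hx,
        s_of_le hj, src_hcomp, unit_exchange hi _ _ hx]
      congr 1
      rcases hj.eq_or_lt with rfl | hj'
      · rw [A.s_top le_rfl]
        exact A.comp_congr hi (A.s_top le_rfl _).symm (A.s_top le_rfl _).symm _ _
      · exact A.s_comp hij hi _ _ _ _
    · have e : ∀ c : E.Cell, s j c = c := s_of_lt hj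
      simp only [e]
  t_comp {i j} hij h x y hc ht := by
    rcases le_or_gt j n with hj | hj
    · have hi : i < n := hij.trans_le hj
      have hx : A.t i (A.t j x.tgt) = A.s i (A.t j y.tgt) := by
        rw [A.t_t hij, A.s_t hij, hcomp_aux hi ((composable_iff hi).1 hc)]
      rw [comp_of_lt hi, comp_of_lt hi, hcomp_congr hi (t_of_le hj x) (t_of_le hj y) _ hx,
        t_of_le hj, tgt_hcomp, unit_exchange hi _ _ hx]
      congr 1
      rcases hj.eq_or_lt with rfl | hj'
      · rw [A.t_top le_rfl]
        exact A.comp_congr hi (A.t_top le_rfl _).symm (A.t_top le_rfl _).symm _ _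
      · exact A.t_comp hij hi _ _ _ _
    · have e : ∀ c : E.Cell, t j c = c := t_of_lt hj
      simp only [e]
  assoc {i} h x y z hxy hyz h₁ h₂ := by
    rcases (Nat.lt_succ_iff.1 h).eq_or_lt with rfl | hi
    · simp only [comp_top] at h₁ h₂ ⊢
      exact vcomp_assoc _ _ _ _ _ _ _
    · simp only [comp_of_lt hi] at h₁ h₂ ⊢
      exact hcomp_assoc hi _ _ _ _ _ _ _
  unit_comp {i} h x hc := by
    rcases (Nat.lt_succ_iff.1 h).eq_or_lt with rfl | hi
    · rw [comp_top]
      have e : s i x = unit x.src := by rw [s_of_le le_rfl, A.s_top le_rfl]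
      exact (vcomp_congr e rfl _ rfl).trans (unit_vcomp x _ rfl)
    · rw [comp_of_lt hi]
      have e : s i x = unit (A.s i x.src) := s_of_le hi.le x
      exact (hcomp_congr hi e rfl _ (A.t_s_self i _)).trans (unit_hcomp hi x _)
  comp_unit {i} h x hc := by
    rcases (Nat.lt_succ_iff.1 h).eq_or_lt with rfl | hi
    · rw [comp_top]
      have e : t i x = unit x.tgt := by rw [t_of_le le_rfl, A.t_top le_rfl]
      exact (vcomp_congr rfl e _ rfl).trans (vcomp_unit x _ rfl)
    · rw [comp_of_lt hi]
      have e : t i x = unit (A.t i x.tgt) := t_of_le hi.le x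
      exact (hcomp_congr hi rfl e _ (by
        rw [src_unit, A.s_t_self, (x.parallel hi).2])).trans (hcomp_unit hi x _)
  exchange {i j} hij hi hj x y z w hxy hzw hxz hyw h₁ h₂ := by
    have hi' : i < n := by omega
    rcases (Nat.lt_succ_iff.1 hj).eq_or_lt with rfl | hj'
    · simp only [comp_of_lt hi', comp_top] at h₁ h₂ ⊢
      exact hcomp_vcomp hi' _ _ _ _ _ _ _ _ _ _
    · simp only [comp_of_lt hi', comp_of_lt hj'] at h₁ h₂ ⊢
      exact hcomp_hcomp hij hi' hj' _ _ _ _ _ _ _ _ _ _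

/-- The data which identify the `n`-category `A` with the `n`-dimensional truncation of the
`(n + 1)`-category `B`: sources, targets and units between the `(n + 1)`-cells and the `n`-cells. -/
structure Truncation {n : ℕ} (A : NCat.{u} n) (B : NCat.{u} (n + 1)) where
  src : B.cell → A.cell
  tgt : B.cell → A.cell
  unit : A.cell → B.cell
  src_unit : ∀ x, src (unit x) = x
  tgt_unit : ∀ x, tgt (unit x) = x
  s_eq : ∀ {i : ℕ}, i ≤ n → ∀ x, B.s i x = unit (A.s i (src x))
  t_eq : ∀ {i : ℕ}, i ≤ n → ∀ x, B.t i x = unit (A.t i (tgt x))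
  src_comp_top : ∀ (h : n < n + 1) (x y : B.cell) (hc : B.t n x = B.s n y),
    src (B.comp n h x y hc) = src x
  tgt_comp_top : ∀ (h : n < n + 1) (x y : B.cell) (hc : B.t n x = B.s n y),
    tgt (B.comp n h x y hc) = tgt y
  src_comp : ∀ {i : ℕ} (h : i < n) (h' : i < n + 1) (x y : B.cell) (hc : B.t i x = B.s i y)
    (hs : A.t i (src x) = A.s i (src y)), src (B.comp i h' x y hc) = A.comp i h (src x) (src y) hs
  tgt_comp : ∀ {i : ℕ} (h : i < n) (h' : i < n + 1) (x y : B.cell) (hc : B.t i x = B.s i y)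
    (ht : A.t i (tgt x) = A.s i (tgt y)), tgt (B.comp i h' x y hc) = A.comp i h (tgt x) (tgt y) ht
  unit_comp : ∀ {i : ℕ} (h : i < n) (h' : i < n + 1) (x y : A.cell) (hc : A.t i x = A.s i y)
    (hu : B.t i (unit x) = B.s i (unit y)),
    unit (A.comp i h x y hc) = B.comp i h' (unit x) (unit y) hu

open CellExt.Cell in
/-- Attaching `(n + 1)`-cells to an `n`-category does not change its `n`-dimensional truncation. -/
noncomputable def CellExt.truncation {n : ℕ} {A : NCat.{u} n} (E : CellExt A) :
    Truncation A E.free where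
  src := CellExt.Cell.src
  tgt := CellExt.Cell.tgt
  unit := CellExt.Cell.unit
  src_unit _ := rfl
  tgt_unit _ := rfl
  s_eq h x := s_of_le h x
  t_eq h x := t_of_le h x
  src_comp_top h x y hc := (congrArg CellExt.Cell.src (comp_top h hc)).trans (src_vcomp x y _)
  tgt_comp_top h x y hc := (congrArg CellExt.Cell.tgt (comp_top h hc)).trans (tgt_vcomp x y _)
  src_comp h h' x y hc _ := (congrArg CellExt.Cell.src (comp_of_lt h h' hc)).trans (src_hcomp h x y _)
  tgt_comp h h' x y hc _ := (congrArg CellExt.Cell.tgt (comp_of_lt h h' hc)).trans (tgt_hcomp h x y _)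
  unit_comp h h' x y hc hu := ((comp_of_lt h h' hu).trans (unit_exchange h x y hc)).symm

namespace Truncation

variable {n : ℕ} {A : NCat.{u} n} {B : NCat.{u} (n + 1)} (T : Truncation A B)

/-- Transport of a truncation along an equality of `n`-categories. -/
def cast {A' : NCat.{u} n} (h : A = A') (T : Truncation A B) : Truncation A' B := h ▸ T

theorem unit_inj {x y : A.cell} (h : T.unit x = T.unit y) : x = y := by
  rw [← T.src_unit x, h, T.src_unit]

theorem s_top (x : B.cell) : B.s n x = T.unit (T.src x) := by
  rw [T.s_eq le_rfl, A.s_top le_rfl]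

theorem t_top (x : B.cell) : B.t n x = T.unit (T.tgt x) := by
  rw [T.t_eq le_rfl, A.t_top le_rfl]

theorem src_src_eq {C : NCat.{u} (n + 2)} (U : Truncation B C) (x : C.cell) :
    T.src (U.src x) = T.src (U.tgt x) := by
  have e := C.s_t (Nat.lt_succ_self n) x
  rw [U.s_eq (Nat.le_succ n), U.s_eq (Nat.le_succ n), U.t_top, U.src_unit] at e
  have e' := U.unit_inj e
  rw [T.s_top, T.s_top] at e'
  exact (T.unit_inj e').symm

theorem tgt_src_eq {C : NCat.{u} (n + 2)} (U : Truncation B C) (x : C.cell) :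
    T.tgt (U.src x) = T.tgt (U.tgt x) := by
  have e := C.t_s (Nat.lt_succ_self n) x
  rw [U.t_eq (Nat.le_succ n), U.t_eq (Nat.le_succ n), U.s_top, U.tgt_unit] at e
  have e' := U.unit_inj e
  rw [T.t_top, T.t_top] at e'
  exact T.unit_inj e'

end Truncation

namespace OmegaCat

variable (X : ∀ n, NCat.{u} n) (T : ∀ n, Truncation (X n) (X (n + 1)))

/-- The globular set with units of the cells of a tower of `n`-categories. -/
abbrev towerCells : UnitalGlobularSet.{u} where
  cell n := (X n).cell
  src {n} := (T n).src
  tgt {n} := (T n).tgt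
  src_src_eq {n} := (T n).src_src_eq (T (n + 1))
  tgt_src_eq {n} := (T n).tgt_src_eq (T (n + 1))
  unit {n} := (T n).unit
  src_unit {n} := (T n).src_unit
  tgt_unit {n} := (T n).tgt_unit

theorem tower_unitI_self {n : ℕ} (h : n ≤ n) (x : (X n).cell) :
    (towerCells X T).unitI h x = x :=
  Nat.leRecOn_self (C := fun n => (X n).cell) x

theorem tower_unitI_succ {i n : ℕ} (h : i ≤ n) (h' : i ≤ n + 1) (x : (X i).cell) :
    (towerCells X T).unitI h' x = (T n).unit ((towerCells X T).unitI h x) :=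
  Nat.leRecOn_succ (C := fun n => (X n).cell) h x

theorem tower_unitI_srcI {i n : ℕ} (h : i ≤ n) (x : (X n).cell) :
    (towerCells X T).unitI h ((towerCells X T).srcI h x) = (X n).s i x := by
  induction n, h using Nat.le_induction with
  | base =>
    exact (tower_unitI_self X T le_rfl _).trans
      (((towerCells X T).srcI_self le_rfl x).trans ((X i).s_top le_rfl x).symm)
  | succ n h ih =>
    have e := (towerCells X T).srcI_succ h (Nat.le_succ_of_le h) x
    rw [(T n).s_eq h, ← ih]
    exact (tower_unitI_succ X T h _ _).trans
      (congrArg (fun z => (T n).unit ((towerCells X T).unitI h z)) e)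

theorem tower_unitI_tgtI {i n : ℕ} (h : i ≤ n) (x : (X n).cell) :
    (towerCells X T).unitI h ((towerCells X T).tgtI h x) = (X n).t i x := by
  induction n, h using Nat.le_induction with
  | base =>
    exact (tower_unitI_self X T le_rfl _).trans
      (((towerCells X T).tgtI_self le_rfl x).trans ((X i).t_top le_rfl x).symm)
  | succ n h ih =>
    have e := (towerCells X T).tgtI_succ h (Nat.le_succ_of_le h) x
    rw [(T n).t_eq h, ← ih]
    exact (tower_unitI_succ X T h _ _).trans
      (congrArg (fun z => (T n).unit ((towerCells X T).unitI h z)) e)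

theorem tower_composable {i n : ℕ} {h : i ≤ n} {x y : (X n).cell}
    (hc : (towerCells X T).tgtI h x = (towerCells X T).srcI h y) : (X n).t i x = (X n).s i y := by
  rw [← tower_unitI_tgtI X T h x, ← tower_unitI_srcI X T h y, hc]

theorem tower_comp_congr {i n : ℕ} (h : i < n) {x y x' y' : (X n).cell} (hx : x' = x)
    (hy : y' = y) (hc : (X n).t i x = (X n).s i y) (hc' : (X n).t i x' = (X n).s i y') :
    (X n).comp i h x y hc = (X n).comp i h x' y' hc' := by
  subst hx hy; rfl

/-- The `∞`-category whose truncations are the terms of a tower of `n`-categories. -/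
def ofTower : OmegaCat.{u} where
  toUnitalGlobularSet := towerCells X T
  comp {n} i h x y hc := (X n).comp i h x y (tower_composable X T hc)
  src_comp_top {n} x y h hc := (T n).src_comp_top h x y _
  tgt_comp_top {n} x y h hc := (T n).tgt_comp_top h x y _
  src_comp {n i} h h' x y hc hs := (T n).src_comp h h' x y _ _
  tgt_comp {n i} h h' x y hc ht := (T n).tgt_comp h h' x y _ _
  assoc {n i} h x y z hxy hyz h₁ h₂ := (X n).assoc h x y z _ _ _ _
  unit_comp {n i} h x hc := by
    have e := tower_unitI_srcI X T h.le x
    exact (tower_comp_congr X h e.symm rfl _ ((X n).t_s_self i x)).trans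
      ((X n).unit_comp h x _)
  comp_unit {n i} h x hc := by
    have e := tower_unitI_tgtI X T h.le x
    exact (tower_comp_congr X h rfl e.symm _ ((X n).s_t_self i x).symm).trans
      ((X n).comp_unit h x _)
  exchange {n i j} hij hj hi x y z t hxy hzt hxz hyt h₁ h₂ :=
    (X n).exchange hij hi hj x y z t _ _ _ _ _ _
  unit_exchange {n i} h h' x y hc hu := (T n).unit_comp h h' x y _ _

end OmegaCat

/-- The `n`-polygraphs and the free `n`-categories which they generate, by simultaneous induction
on `n`: a `0`-polygraph is a set `S`, which generates the `0`-category `S`; an `(n + 1)`-polygraph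
is an `n`-polygraph together with a set of `(n + 1)`-cells attached to the free `n`-category which
it generates. -/
noncomputable def nPolygraphs : (n : ℕ) → (P : Type (u + 1)) × (P → NCat.{u} n)
  | 0 => ⟨Type u, NCat.discrete⟩
  | n + 1 => ⟨(P : (nPolygraphs n).1) × CellExt ((nPolygraphs n).2 P), fun P => P.2.free⟩

/-- An `n`-polygraph. -/
def NPolygraph (n : ℕ) : Type (u + 1) := (nPolygraphs.{u} n).1

namespace NPolygraph

/-- The free `n`-category generated by an `n`-polygraph. -/
noncomputable def free {n : ℕ} (P : NPolygraph.{u} n) : NCat.{u} n := (nPolygraphs n).2 P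

/-- The underlying `n`-polygraph of an `(n + 1)`-polygraph. -/
def restrict {n : ℕ} (P : NPolygraph.{u} (n + 1)) : NPolygraph.{u} n := P.1

/-- The `(n + 1)`-cells of an `(n + 1)`-polygraph. -/
def ext {n : ℕ} (P : NPolygraph.{u} (n + 1)) : CellExt P.restrict.free := P.2

/-- The free `(n + 1)`-category generated by an `(n + 1)`-polygraph has as its `n`-dimensional
truncation the free `n`-category generated by the underlying `n`-polygraph. -/
noncomputable def truncation {n : ℕ} (P : NPolygraph.{u} (n + 1)) :
    Truncation P.restrict.free P.free := P.ext.truncation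

end NPolygraph

/-- A polygraph: an infinite sequence whose first items form an `n`-polygraph for each `n`. -/
structure Polygraph where
  toNPolygraph : ∀ n : ℕ, NPolygraph.{u} n
  restrict_eq : ∀ n : ℕ, (toNPolygraph (n + 1)).restrict = toNPolygraph n

/-- The free `∞`-category `S*` generated by a polygraph `S`: its `n`-dimensional truncation is the
free `n`-category generated by the underlying `n`-polygraph. -/
noncomputable def Polygraph.free (S : Polygraph.{u}) : OmegaCat.{u} :=
  OmegaCat.ofTower (fun n => (S.toNPolygraph n).free) fun n =>
    (S.toNPolygraph (n + 1)).truncation.cast (congrArg NPolygraph.free (S.restrict_eq n))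

/-! Let `g : C ⟶ D` be a trivial fibration. As the complex without cells is initial, a lifting
problem for it against `g` amounts to a morphism `v` from the free complex to `D`, and it suffices
to factor `v` through `g`. The factorization is built by induction on the dimension.

In dimension 0, orthogonality to `∂O_0 → O_0` says that `g` is surjective on 0-cells, so that the
generators can be lifted one by one (`exists_lift_zero`). Now suppose that a lift `f` is known on
the free `n`-category. The source and target of an attached `(n + 1)`-cell `a` are parallel, so `f`
sends them to parallel `n`-cells of `C`, that is, to a morphism from `∂O_{n+1}`; the cell `v a` of
`D` fills its image under `g`. Orthogonality to `∂O_{n+1} → O_{n+1}` yields a cell of `C` over `v a`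
with the prescribed boundary (`exists_lift_succ`). The cells so chosen determine an extension of `f`
to the free `(n + 1)`-category: formal compositions are evaluated in `C`, and the congruence on them
is respected because each of its clauses is a law of complexes (`eval_eq_of_rel`). The extension
still lies over `v`, since the two agree on attached cells and on units and both preserve
compositions (`CellExt.exists_extend`). Iterating these extensions gives a compatible sequence of
maps, which is a morphism from the free complex (`Polygraph.exists_lift`).

Two translations support this. Parallel cells and single cells must be turned into morphisms from
spheres and globes (`Cone.hom`). Moreover an `NCat` only has `n`-cells, its lower cells being
iterated units; this is harmless because iterated units are injective. -/

namespace OmegaCat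

/-! ### Iterated units, iterated boundaries and parallel cells -/

variable (C : OmegaCat.{u})

theorem unitI_self {n : ℕ} (h : n ≤ n) (x : C.cell n) : C.unitI h x = x :=
  Nat.leRecOn_self (C := C.cell) x

theorem unitI_succ {i n : ℕ} (h : i ≤ n) (h' : i ≤ n + 1) (x : C.cell i) :
    C.unitI h' x = C.unit (C.unitI h x) :=
  Nat.leRecOn_succ (C := C.cell) h x

theorem srcI_top {n : ℕ} (h : n ≤ n + 1) (x : C.cell (n + 1)) : C.srcI h x = C.src x := by
  rw [C.srcI_succ le_rfl, C.srcI_self]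

theorem tgtI_top {n : ℕ} (h : n ≤ n + 1) (x : C.cell (n + 1)) : C.tgtI h x = C.tgt x := by
  rw [C.tgtI_succ le_rfl, C.tgtI_self]

theorem srcI_unitI {i n : ℕ} (h : i ≤ n) (x : C.cell i) : C.srcI h (C.unitI h x) = x := by
  induction n, h using Nat.le_induction with
  | base => rw [C.srcI_self, C.unitI_self]
  | succ n h ih => rw [C.srcI_succ h, C.unitI_succ h, C.src_unit, ih]

theorem tgtI_unitI {i n : ℕ} (h : i ≤ n) (x : C.cell i) : C.tgtI h (C.unitI h x) = x := by
  induction n, h using Nat.le_induction with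
  | base => rw [C.tgtI_self, C.unitI_self]
  | succ n h ih => rw [C.tgtI_succ h, C.unitI_succ h, C.tgt_unit, ih]

theorem unitI_trans {i j n : ℕ} (h : i ≤ j) (h' : j ≤ n) (h'' : i ≤ n) (x : C.cell i) :
    C.unitI h' (C.unitI h x) = C.unitI h'' x := by
  induction n, h' using Nat.le_induction with
  | base => rw [C.unitI_self]
  | succ n h' ih => rw [C.unitI_succ h', C.unitI_succ (h.trans h'), ih]

theorem unitI_injective {i n : ℕ} (h : i ≤ n) {x y : C.cell i}
    (e : C.unitI h x = C.unitI h y) : x = y := by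
  rw [← C.srcI_unitI h x, e, C.srcI_unitI]

theorem src_srcI {i n : ℕ} (h : i + 1 ≤ n) (h' : i ≤ n) (x : C.cell n) :
    C.src (C.srcI h x) = C.srcI h' x := by
  induction n, h using Nat.le_induction with
  | base => rw [C.srcI_self, C.srcI_top]
  | succ n h ih => rw [C.srcI_succ h, C.srcI_succ (Nat.le_of_succ_le h), ih]

theorem tgt_tgtI {i n : ℕ} (h : i + 1 ≤ n) (h' : i ≤ n) (x : C.cell n) :
    C.tgt (C.tgtI h x) = C.tgtI h' x := by
  induction n, h using Nat.le_induction with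
  | base => rw [C.tgtI_self, C.tgtI_top]
  | succ n h ih => rw [C.tgtI_succ h, C.tgtI_succ (Nat.le_of_succ_le h), ih]

/-- Two `n`-cells are parallel if `n = 0` or if they have the same source and the same target. -/
def Parallel : ∀ {n : ℕ}, C.cell n → C.cell n → Prop
  | 0, _, _ => True
  | _ + 1, x, y => C.src x = C.src y ∧ C.tgt x = C.tgt y

theorem parallel_src_tgt {n : ℕ} (x : C.cell (n + 1)) : C.Parallel (C.src x) (C.tgt x) := by
  cases n with
  | zero => trivial
  | succ n => exact ⟨C.src_src_eq x, C.tgt_src_eq x⟩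

variable {C}

theorem Parallel.srcI_eq {i n : ℕ} {x y : C.cell n} (h : C.Parallel x y) (hi : i < n) :
    C.srcI hi.le x = C.srcI hi.le y := by
  cases n with
  | zero => omega
  | succ n =>
    rw [C.srcI_succ (Nat.le_of_lt_succ hi), C.srcI_succ (Nat.le_of_lt_succ hi), h.1]

theorem Parallel.tgtI_eq {i n : ℕ} {x y : C.cell n} (h : C.Parallel x y) (hi : i < n) :
    C.tgtI hi.le x = C.tgtI hi.le y := by
  cases n with
  | zero => omega
  | succ n =>
    rw [C.tgtI_succ (Nat.le_of_lt_succ hi), C.tgtI_succ (Nat.le_of_lt_succ hi), h.2]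

-- Since `C.src x` and `C.tgt x` are parallel, their `i`-dimensional sources coincide when `i` is
-- smaller than their dimension; this reduces the claim for `x` to the claim for `C.tgt x`.
variable (C) in
theorem parallel_srcI_tgtI {i n : ℕ} (h : i < n) (x : C.cell n) :
    C.Parallel (C.srcI h.le x) (C.tgtI h.le x) := by
  induction n, h using Nat.le_induction with
  | base => rw [C.srcI_top, C.tgtI_top]; exact C.parallel_src_tgt x
  | succ n h ih =>
    have hi : i < n := h
    rw [C.srcI_succ hi.le, C.tgtI_succ hi.le, (C.parallel_src_tgt x).srcI_eq hi]
    exact ih _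

/-- Together with `Parallel.tgt_srcI`, this is the mixed boundary condition needed for a pair of
parallel cells to define a morphism from a sphere. In the top dimension it uses that `x` and `y` are
parallel; below it, globularity applied to a single cell. -/
theorem Parallel.src_tgtI {i n : ℕ} {x y : C.cell n} (h : C.Parallel x y) (h₁ : i + 1 ≤ n)
    (h₂ : i ≤ n) : C.src (C.tgtI h₁ y) = C.srcI h₂ x := by
  rw [h.srcI_eq h₁, ← C.src_srcI h₁]
  rcases h₁.eq_or_lt with rfl | hn
  · rw [C.tgtI_self, C.srcI_self]
  · exact (C.parallel_srcI_tgtI hn y).1.symm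

theorem Parallel.tgt_srcI {i n : ℕ} {x y : C.cell n} (h : C.Parallel x y) (h₁ : i + 1 ≤ n)
    (h₂ : i ≤ n) : C.tgt (C.srcI h₁ x) = C.tgtI h₂ y := by
  rw [← h.tgtI_eq h₁, ← C.tgt_tgtI h₁]
  rcases h₁.eq_or_lt with rfl | hn
  · rw [C.tgtI_self, C.srcI_self]
  · exact (C.parallel_srcI_tgtI hn x).2

theorem comp_congr {n i : ℕ} (h : i < n) {x y x' y' : C.cell n} (hx : x = x') (hy : y = y')
    (hc : C.tgtI h.le x = C.srcI h.le y) (hc' : C.tgtI h.le x' = C.srcI h.le y') :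
    C.comp i h x y hc = C.comp i h x' y' hc' := by
  subst hx hy; rfl

theorem Hom.map_unitI {C D : OmegaCat.{u}} (f : Hom C D) {i n : ℕ} (h : i ≤ n) (x : C.cell i) :
    f.map (C.unitI h x) = D.unitI h (f.map x) := by
  induction n, h using Nat.le_induction with
  | base => simp only [unitI_self]
  | succ n h ih =>
    rw [C.unitI_succ h, D.unitI_succ h, f.map_unit, ih]

end OmegaCat

/-! ### Morphisms from globes and spheres -/

namespace GlobeShape

/-- The images of the generating cells under a morphism from the `∞`-category generated by
a shape. -/
structure Cone (A : GlobeShape) (C : OmegaCat.{u}) where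
  pt : ∀ (k : ℕ) (b : Bool), A.mem k b → C.cell k
  src_pt : ∀ (k : ℕ) (b : Bool) (h : A.mem (k + 1) b) (h' : A.mem k false),
    C.src (pt (k + 1) b h) = pt k false h'
  tgt_pt : ∀ (k : ℕ) (b : Bool) (h : A.mem (k + 1) b) (h' : A.mem k true),
    C.tgt (pt (k + 1) b h) = pt k true h'

namespace Cone

variable {A : GlobeShape} {C : OmegaCat.{u}} (c : A.Cone C)

/-- The image of a cell. -/
def app {p : ℕ} (x : Cell.{u} A p) : C.cell p := C.unitI x.dim_le (c.pt x.dim x.sign x.mem)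

/-- Either `x` is a unit, and taking a boundary removes one unit, or `x` is a generating cell of
dimension `p + 1`, and the boundary conditions of the cone apply. -/
theorem app_bd {p : ℕ} (x : Cell.{u} A (p + 1)) :
    c.app (x.bd false) = C.src (c.app x) ∧ c.app (x.bd true) = C.tgt (c.app x) := by
  rcases x with ⟨k, b, hm, hk⟩
  rcases Nat.le_succ_iff.1 hk with h | rfl
  · simp only [Cell.bd, dif_pos h]
    refine ⟨?_, ?_⟩ <;> simp only [app]
    · rw [C.unitI_succ h, C.src_unit]
    · rw [C.unitI_succ h, C.tgt_unit]
  · simp only [Cell.bd, dif_neg (Nat.not_succ_le_self p)]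
    simp only [app, C.unitI_self]
    exact ⟨(c.src_pt _ _ _ _).symm, (c.tgt_pt _ _ _ _).symm⟩

theorem unitI_srcI_app {i p : ℕ} (h : i ≤ p) (x : Cell.{u} A p) (hx : x.dim ≤ i) :
    C.unitI h (C.srcI h (c.app x)) = c.app x := by
  unfold app
  rw [← C.unitI_trans hx h, C.srcI_unitI]

theorem unitI_tgtI_app {i p : ℕ} (h : i ≤ p) (x : Cell.{u} A p) (hx : x.dim ≤ i) :
    C.unitI h (C.tgtI h (c.app x)) = c.app x := by
  unfold app
  rw [← C.unitI_trans hx h, C.tgtI_unitI]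

/-- One of two composable cells is an iterated unit on an `i`-cell, so the unit laws of `C` compute
the composite of the images. -/
theorem app_comp {n i : ℕ} (h : i < n) (x y : Cell.{u} A n)
    (hc : A.cells.tgtI h.le x = A.cells.srcI h.le y)
    (hd : C.tgtI h.le (c.app x) = C.srcI h.le (c.app y)) :
    c.app (Cell.comp i x y) = C.comp i h (c.app x) (c.app y) hd := by
  unfold Cell.comp
  split_ifs with hx
  · have e : c.app x = C.unitI h.le (C.srcI h.le (c.app y)) := by
      rw [← hd, c.unitI_tgtI_app h.le x hx]
    rw [OmegaCat.comp_congr h e rfl hd (e ▸ hd), C.unit_comp]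
  · have hy : y.dim ≤ i := by
      -- If both dimensions exceeded `i`, the `i`-dimensional target of `x` would have sign `true`
      -- and the `i`-dimensional source of `y` sign `false`.
      by_contra hy
      have hsign := ((composable_iff A).1 hc).2
      rw [if_neg hx, if_neg hy] at hsign
      cases hsign
    have e : c.app y = C.unitI h.le (C.tgtI h.le (c.app x)) := by
      rw [hd, c.unitI_srcI_app h.le y hy]
    rw [OmegaCat.comp_congr h rfl e hd (e ▸ hd), C.comp_unit]

/-- The morphism from the `∞`-category generated by a shape, with given values on the
generating cells. -/
def hom : A.omegaCat ⟶ C where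
  map x := c.app x
  map_src x := (c.app_bd x).1
  map_tgt x := (c.app_bd x).2
  map_unit x := C.unitI_succ x.dim_le _ _
  map_comp h x y hc hd := c.app_comp h x y hc hd

/-- The sphere given by a pair of parallel cells. -/
def sphere {n : ℕ} {x y : C.cell n} (h : C.Parallel x y) :
    (GlobeShape.sphere (n + 1)).Cone C where
  -- In dimension `n` the values are `x` and `y` themselves; below it, parallelism makes it
  -- immaterial which of the two cells is used.
  pt k b hk := if b then C.tgtI (Nat.le_of_lt_succ hk) y else C.srcI (Nat.le_of_lt_succ hk) x
  src_pt k b hk hk' := by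
    cases b
    · exact C.src_srcI _ _ _
    · exact h.src_tgtI _ _
  tgt_pt k b hk hk' := by
    cases b
    · exact h.tgt_srcI _ _
    · exact C.tgt_tgtI _ _ _

theorem le_of_mem_ball {n k : ℕ} {b : Bool} (h : (GlobeShape.ball n).mem k b) : k ≤ n :=
  h.elim Nat.le_of_lt fun h => h.1.le

/-- The globe given by a cell. -/
def ball {n : ℕ} (x : C.cell n) : (GlobeShape.ball n).Cone C where
  -- In dimension `n` the shape contains only the sign `true`, for which the value is the iterated
  -- target in dimension `n`, namely `x`.
  pt k b hk := if b then C.tgtI (le_of_mem_ball hk) x else C.srcI (le_of_mem_ball hk) x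
  src_pt k b hk hk' := by
    have h : C.Parallel x x := by cases n <;> simp [OmegaCat.Parallel]
    cases b
    · exact C.src_srcI _ _ _
    · exact h.src_tgtI _ _
  tgt_pt k b hk hk' := by
    have h : C.Parallel x x := by cases n <;> simp [OmegaCat.Parallel]
    cases b
    · exact h.tgt_srcI _ _
    · exact C.tgt_tgtI _ _ _

end Cone

end GlobeShape

/-! ### Lifting cells along trivial fibrations -/

namespace OmegaCat

open GlobeShape

/-- The non-degenerate `n`-cell of the globe `O_n`. -/
def globeTop (n : ℕ) : (globe.{u} n).cell n := Cell.mk n true (Or.inr ⟨rfl, rfl⟩) le_rfl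

theorem ball_hom_globeTop {D : OmegaCat.{u}} {n : ℕ} (d : D.cell n) :
    Hom.map (Cone.ball d).hom (globeTop n) = d := by
  exact (D.unitI_self le_rfl _).trans (D.tgtI_self le_rfl d)

/-- The boundary of `O_0` has no cells, so a lifting problem against its inclusion is just a 0-cell
of `D`. -/
theorem exists_lift_zero {C D : OmegaCat.{u}} {g : C ⟶ D} (hg : trivialFibrations g)
    (d : D.cell 0) : ∃ c : C.cell 0, Hom.map g c = d := by
  have hl := hg _ (MorphismProperty.ofHoms.mk 0)
  let u : globeBoundary.{u} 0 ⟶ C :=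
    Cone.hom ⟨fun _ _ h => absurd h (Nat.not_lt_zero _), fun _ _ h => absurd h (Nat.not_lt_zero _),
      fun _ _ h => absurd h (Nat.not_lt_zero _)⟩
  let v : globe.{u} 0 ⟶ D := (Cone.ball d).hom
  have sq : CommSq u (boundaryInclusion 0) g v :=
    ⟨Hom.ext (by funext _ x; exact absurd (Cell.mem x) (Nat.not_lt_zero _))⟩
  obtain ⟨l⟩ := (hl.sq_hasLift sq).exists_lift
  refine ⟨Hom.map l.l (globeTop 0), ?_⟩
  exact (congrArg (fun f : globe.{u} 0 ⟶ D => Hom.map f (globeTop 0)) l.fac_right).trans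
    (ball_hom_globeTop d)

/-- The parallel pair is a morphism from `∂O_{n+1}` and `d` is a morphism from `O_{n+1}`; the cell
sought is the image of the top cell under a diagonal filler. -/
theorem exists_lift_succ {C D : OmegaCat.{u}} {g : C ⟶ D} (hg : trivialFibrations g)
    {n : ℕ} {x y : C.cell n} (h : C.Parallel x y) (d : D.cell (n + 1))
    (hs : D.src d = Hom.map g x) (ht : D.tgt d = Hom.map g y) :
    ∃ c : C.cell (n + 1), C.src c = x ∧ C.tgt c = y ∧ Hom.map g c = d := by
  have hl := hg _ (MorphismProperty.ofHoms.mk (n + 1))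
  let u : globeBoundary.{u} (n + 1) ⟶ C := (Cone.sphere h).hom
  let v : globe.{u} (n + 1) ⟶ D := (Cone.ball d).hom
  have sq : CommSq u (boundaryInclusion (n + 1)) g v := by
    refine ⟨Hom.ext ?_⟩
    funext p x
    rcases x with ⟨k, b, hm, hk⟩
    have hm' : k ≤ n := Nat.le_of_lt_succ hm
    -- Both composites send a cell to the iterated unit on the image of its generator, so it is
    -- enough to compare generators.
    change Hom.map g (C.unitI hk (if b then C.tgtI hm' _ else C.srcI hm' _)) =
      D.unitI hk (if b then D.tgtI (Nat.le_succ_of_le hm') d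
        else D.srcI (Nat.le_succ_of_le hm') d)
    rw [Hom.map_unitI]
    congr 1
    cases b
    · exact (Hom.map_srcI g _ _).trans (by rw [D.srcI_succ hm', hs]; rfl)
    · exact (Hom.map_tgtI g _ _).trans (by rw [D.tgtI_succ hm', ht]; rfl)
  obtain ⟨l⟩ := (hl.sq_hasLift sq).exists_lift
  have key : ∀ z : (globeBoundary.{u} (n + 1)).cell n,
      Hom.map l.l (Hom.map (boundaryInclusion (n + 1)) z) = Hom.map u z := fun z =>
    congrArg (fun f : globeBoundary.{u} (n + 1) ⟶ C => Hom.map f z) l.fac_left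
  refine ⟨Hom.map l.l (globeTop (n + 1)), ?_, ?_, ?_⟩
  · rw [← Hom.map_src]
    -- The source of the top cell comes from the boundary, where the filler is prescribed.
    have e : (globe.{u} (n + 1)).src (globeTop (n + 1)) =
        Hom.map (boundaryInclusion (n + 1)) (Cell.mk n false (Nat.lt_succ_self n) le_rfl) :=
      dif_neg (Nat.not_succ_le_self n)
    exact (congrArg (Hom.map l.l) e).trans ((key _).trans
      ((C.unitI_self le_rfl _).trans (C.srcI_self le_rfl x)))
  · rw [← Hom.map_tgt]
    have e : (globe.{u} (n + 1)).tgt (globeTop (n + 1)) =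
        Hom.map (boundaryInclusion (n + 1)) (Cell.mk n true (Nat.lt_succ_self n) le_rfl) :=
      dif_neg (Nat.not_succ_le_self n)
    exact (congrArg (Hom.map l.l) e).trans ((key _).trans
      ((C.unitI_self le_rfl _).trans (C.tgtI_self le_rfl y)))
  · exact (congrArg (fun f : globe.{u} (n + 1) ⟶ D => Hom.map f (globeTop (n + 1)))
      l.fac_right).trans (ball_hom_globeTop d)

end OmegaCat

/-! ### Maps from an `n`-category to a complex -/

/-- A morphism from an `n`-category to the `n`-dimensional truncation of an `∞`-category. -/
structure NCat.Map {n : ℕ} (A : NCat.{u} n) (C : OmegaCat.{u}) where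
  map : A.cell → C.cell n
  map_s : ∀ {i : ℕ} (h : i ≤ n) (x : A.cell), map (A.s i x) = C.unitI h (C.srcI h (map x))
  map_t : ∀ {i : ℕ} (h : i ≤ n) (x : A.cell), map (A.t i x) = C.unitI h (C.tgtI h (map x))
  map_comp : ∀ {i : ℕ} (h : i < n) (x y : A.cell) (hc : A.t i x = A.s i y)
    (hd : C.tgtI h.le (map x) = C.srcI h.le (map y)),
    map (A.comp i h x y hc) = C.comp i h (map x) (map y) hd

namespace NCat.Map

variable {n : ℕ} {A : NCat.{u} n} {C : OmegaCat.{u}} (f : A.Map C)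

theorem composable {i : ℕ} (h : i ≤ n) {x y : A.cell} (hc : A.t i x = A.s i y) :
    C.tgtI h (f.map x) = C.srcI h (f.map y) :=
  C.unitI_injective h (by rw [← f.map_t, ← f.map_s, hc])

theorem parallel {x y : A.cell} (h : ∀ {i : ℕ}, i < n → A.s i x = A.s i y ∧ A.t i x = A.t i y) :
    C.Parallel (f.map x) (f.map y) := by
  cases n with
  | zero => trivial
  | succ n =>
    have hs := congrArg f.map (h n.lt_succ_self).1
    have ht := congrArg f.map (h n.lt_succ_self).2
    rw [f.map_s n.le_succ, f.map_s n.le_succ] at hs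
    rw [f.map_t n.le_succ, f.map_t n.le_succ] at ht
    have hs' := C.unitI_injective _ hs
    have ht' := C.unitI_injective _ ht
    rw [C.srcI_top, C.srcI_top] at hs'
    rw [C.tgtI_top, C.tgtI_top] at ht'
    exact ⟨hs', ht'⟩

/-- A map from a set to the `0`-cells, as a map from the discrete `0`-category. -/
def ofDiscrete {S : Type u} (f : S → C.cell 0) : (NCat.discrete S).Map C where
  map := f
  map_s h x := by
    obtain rfl := Nat.le_zero.1 h
    rw [C.unitI_self, C.srcI_self]; rfl
  map_t h x := by
    obtain rfl := Nat.le_zero.1 h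
    rw [C.unitI_self, C.tgtI_self]; rfl
  map_comp h := absurd h (Nat.not_lt_zero _)

/-- The compatibility of maps defined on an `n`-category and on an `(n + 1)`-category of which it
is the truncation. -/
structure Compat {B : NCat.{u} (n + 1)} (T : Truncation A B) (f : A.Map C) (F : B.Map C) :
    Prop where
  src : ∀ x, f.map (T.src x) = C.src (F.map x)
  tgt : ∀ x, f.map (T.tgt x) = C.tgt (F.map x)
  unit : ∀ x, F.map (T.unit x) = C.unit (f.map x)

end NCat.Map

/-! ### The universal property of the free `(n + 1)`-category -/

namespace CellExt

variable {n : ℕ} {A : NCat.{u} n} (E : CellExt A) {C : OmegaCat.{u}}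

/-- The images of attached cells under an extension of a map. -/
structure GenMap (f : A.Map C) where
  val : E.gen → C.cell (n + 1)
  src_val : ∀ a, C.src (val a) = f.map (E.src a)
  tgt_val : ∀ a, C.tgt (val a) = f.map (E.tgt a)

namespace GenMap

variable {E} {f : A.Map C} (φ : E.GenMap f)

theorem composable_top {x y z w : A.cell}
    (a : {c : C.cell (n + 1) // C.src c = f.map x ∧ C.tgt c = f.map y})
    (b : {c : C.cell (n + 1) // C.src c = f.map z ∧ C.tgt c = f.map w}) (h : y = z) :
    C.tgtI (Nat.le_succ n) a.1 = C.srcI (Nat.le_succ n) b.1 := by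
  rw [C.tgtI_top, C.srcI_top, a.2.2, b.2.1, h]

/-- For `i < n` the `i`-dimensional source of `b` can be read off from its target, since its source
and target are parallel. -/
theorem composable_of_lt {i : ℕ} (hi : i < n) {x y z w : A.cell}
    (a : {c : C.cell (n + 1) // C.src c = f.map x ∧ C.tgt c = f.map y})
    (b : {c : C.cell (n + 1) // C.src c = f.map z ∧ C.tgt c = f.map w})
    (h : A.t i y = A.s i w) :
    C.tgtI (Nat.lt_succ_of_lt hi).le a.1 = C.srcI (Nat.lt_succ_of_lt hi).le b.1 := by
  rw [C.tgtI_succ hi.le, C.srcI_succ hi.le, a.2.2, (C.parallel_src_tgt b.1).srcI_eq hi, b.2.2,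
    f.composable hi.le h]

/-- The composition `*_n` of `(n + 1)`-cells of `C` lying over `n`-cells of `A`. -/
def vcomp {x y z w : A.cell} (a : {c : C.cell (n + 1) // C.src c = f.map x ∧ C.tgt c = f.map y})
    (b : {c : C.cell (n + 1) // C.src c = f.map z ∧ C.tgt c = f.map w}) (h : y = z) :
    {c : C.cell (n + 1) // C.src c = f.map x ∧ C.tgt c = f.map w} :=
  ⟨C.comp n n.lt_succ_self a.1 b.1 (composable_top a b h),
    (C.src_comp_top _ _ _ _).trans a.2.1, (C.tgt_comp_top _ _ _ _).trans b.2.2⟩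

/-- The composition `*_i`, `i < n`, of `(n + 1)`-cells of `C` lying over `n`-cells of `A`. -/
def hcomp {i : ℕ} (hi : i < n) {x y z w : A.cell}
    (a : {c : C.cell (n + 1) // C.src c = f.map x ∧ C.tgt c = f.map y})
    (b : {c : C.cell (n + 1) // C.src c = f.map z ∧ C.tgt c = f.map w})
    (h : A.t i x = A.s i z) (h' : A.t i y = A.s i w) :
    {c : C.cell (n + 1) // C.src c = f.map (A.comp i hi x z h) ∧
      C.tgt c = f.map (A.comp i hi y w h')} :=
  ⟨C.comp i (Nat.lt_succ_of_lt hi) a.1 b.1 (composable_of_lt hi a b h'),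
    by
      have e := f.composable hi.le h
      rw [f.map_comp hi _ _ _ e, C.src_comp hi _ _ _ _ (by rw [a.2.1, b.2.1, e])]
      exact C.comp_congr hi a.2.1 b.2.1 _ _,
    by
      have e := f.composable hi.le h'
      rw [f.map_comp hi _ _ _ e, C.tgt_comp hi _ _ _ _ (by rw [a.2.2, b.2.2, e])]
      exact C.comp_congr hi a.2.2 b.2.2 _ _⟩

/-- The value of a formal composition. -/
def eval : ∀ {x y : A.cell}, E.Term x y →
    {c : C.cell (n + 1) // C.src c = f.map x ∧ C.tgt c = f.map y}
  -- The boundary is carried along with the value because it is what makes the values of composable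
  -- terms composable.
  | _, _, .gen a => ⟨φ.val a, φ.src_val a, φ.tgt_val a⟩
  | _, _, .unit x => ⟨C.unit (f.map x), C.src_unit _, C.tgt_unit _⟩
  | _, _, .vcomp u v h => vcomp (eval u) (eval v) h
  | _, _, .hcomp _ hi u v h h' => hcomp hi (eval u) (eval v) h h'

/-- Each clause of the congruence evaluates to a law of `C`. The unit clauses first need the
evaluated unit to be recognized as the iterated unit on an iterated boundary, and the clause on
composites of units also uses that `f` preserves compositions. -/
theorem eval_eq_of_rel {x y x' y' : A.cell} {u : E.Term x y} {v : E.Term x' y'}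
    (h : E.Rel u v) : (φ.eval u).1 = (φ.eval v).1 := by
  induction h with
  | refl u => rfl
  | symm _ ih => exact ih.symm
  | trans _ _ ih₁ ih₂ => exact ih₁.trans ih₂
  | vcomp_congr _ _ _ _ ih₁ ih₂ => exact C.comp_congr _ ih₁ ih₂ _ _
  | hcomp_congr hi _ _ _ _ _ _ ih₁ ih₂ => exact C.comp_congr _ ih₁ ih₂ _ _
  | vcomp_assoc u v r h h' => exact C.assoc _ _ _ _ _ _ _ _
  | hcomp_assoc hi u v r => exact C.assoc _ _ _ _ _ _ _ _
  | @unit_vcomp x y z u h =>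
    have e : C.unit (f.map z) = C.unitI n.le_succ (C.srcI n.le_succ (φ.eval u).1) := by
      rw [C.unitI_succ le_rfl, C.unitI_self, C.srcI_top, (φ.eval u).2.1, h]
    exact (C.comp_congr _ e rfl _ (C.tgtI_unitI _ _)).trans (C.unit_comp _ _ _)
  | @vcomp_unit x y z u h =>
    have e : C.unit (f.map z) = C.unitI n.le_succ (C.tgtI n.le_succ (φ.eval u).1) := by
      rw [C.unitI_succ le_rfl, C.unitI_self, C.tgtI_top, (φ.eval u).2.2, h]
    exact (C.comp_congr _ rfl e _ (C.srcI_unitI _ _).symm).trans (C.comp_unit _ _ _)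
  | @unit_hcomp i hi x y u h h' =>
    have hi' : i ≤ n + 1 := Nat.le_succ_of_le hi.le
    have e : C.unit (f.map (A.s i x)) = C.unitI hi' (C.srcI hi' (φ.eval u).1) := by
      rw [C.unitI_succ hi.le, C.srcI_succ hi.le, (φ.eval u).2.1, f.map_s hi.le]
    exact (C.comp_congr _ e rfl _ (C.tgtI_unitI _ _)).trans (C.unit_comp _ _ _)
  | @hcomp_unit i hi x y u h h' =>
    have hi' : i ≤ n + 1 := Nat.le_succ_of_le hi.le
    have e : C.unit (f.map (A.t i y)) = C.unitI hi' (C.tgtI hi' (φ.eval u).1) := by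
      rw [C.unitI_succ hi.le, C.tgtI_succ hi.le, (φ.eval u).2.2, f.map_t hi.le]
    exact (C.comp_congr _ rfl e _ (C.srcI_unitI _ _).symm).trans (C.comp_unit _ _ _)
  | hcomp_vcomp hi u v r q => exact C.exchange hi _ _ _ _ _ _ _ _ _ _ _ _
  | hcomp_hcomp hij hi hj u v r q => exact C.exchange hij _ _ _ _ _ _ _ _ _ _ _ _
  | unit_exchange hi x y h h' =>
    have e := f.composable hi.le h
    exact ((congrArg C.unit (f.map_comp hi _ _ _ e)).trans
      (C.unit_exchange hi (Nat.lt_succ_of_lt hi) _ _ e _)).symm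

/-- The value of a cell of the free `(n + 1)`-category. -/
def evalCell (c : E.Cell) : C.cell (n + 1) :=
  Quotient.lift (fun p : E.Packed => (φ.eval p.term).1) (fun _ _ h => φ.eval_eq_of_rel h) c

theorem src_evalCell (c : E.Cell) : C.src (φ.evalCell c) = f.map c.src := by
  obtain ⟨x, y, u, rfl⟩ := c.exists_mk
  exact (φ.eval u).2.1

theorem tgt_evalCell (c : E.Cell) : C.tgt (φ.evalCell c) = f.map c.tgt := by
  obtain ⟨x, y, u, rfl⟩ := c.exists_mk
  exact (φ.eval u).2.2

theorem evalCell_unit (x : A.cell) : φ.evalCell (Cell.unit x) = C.unit (f.map x) := rfl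

theorem evalCell_vcomp (a b : E.Cell) (h : a.tgt = b.src)
    (hd : C.tgtI n.le_succ (φ.evalCell a) = C.srcI n.le_succ (φ.evalCell b)) :
    φ.evalCell (Cell.vcomp a b h) =
      C.comp n n.lt_succ_self (φ.evalCell a) (φ.evalCell b) hd := by
  obtain ⟨x, x', u, rfl⟩ := a.exists_mk
  obtain ⟨y, y', v, rfl⟩ := b.exists_mk
  exact congrArg φ.evalCell (Cell.vcomp_mk u v h)

theorem evalCell_hcomp {i : ℕ} (hi : i < n) (a b : E.Cell) (h : A.t i a.src = A.s i b.src)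
    (hi' : i < n + 1)
    (hd : C.tgtI hi'.le (φ.evalCell a) = C.srcI hi'.le (φ.evalCell b)) :
    φ.evalCell (Cell.hcomp i hi a b h) = C.comp i hi' (φ.evalCell a) (φ.evalCell b) hd := by
  have k := Cell.hcomp_aux hi h
  obtain ⟨x, x', u, rfl⟩ := a.exists_mk
  obtain ⟨y, y', v, rfl⟩ := b.exists_mk
  exact congrArg φ.evalCell (Cell.hcomp_mk hi u v h k)

/-- The extension of a map to the free `(n + 1)`-category, with given values on the attached
cells. -/
def extend : E.free.Map C where
  map := φ.evalCell
  map_s {i} h c := by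
    -- For `i = n + 1` both sides are the identity by convention; for `i ≤ n` the boundary is a unit
    -- on an `n`-cell, where the map is governed by `f`.
    rcases h.lt_or_eq with h' | rfl
    · have hi := Nat.le_of_lt_succ h'
      refine (congrArg φ.evalCell (Cell.s_of_le hi c)).trans ?_
      rw [φ.evalCell_unit, f.map_s hi, C.unitI_succ hi, C.srcI_succ hi]
      exact congrArg (fun y => C.unit (C.unitI hi (C.srcI hi y))) (φ.src_evalCell c).symm
    · rw [C.unitI_self, C.srcI_self]
      exact congrArg φ.evalCell (Cell.s_of_lt n.lt_succ_self c)
  map_t {i} h c := by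
    rcases h.lt_or_eq with h' | rfl
    · have hi := Nat.le_of_lt_succ h'
      refine (congrArg φ.evalCell (Cell.t_of_le hi c)).trans ?_
      rw [φ.evalCell_unit, f.map_t hi, C.unitI_succ hi, C.tgtI_succ hi]
      exact congrArg (fun y => C.unit (C.unitI hi (C.tgtI hi y))) (φ.tgt_evalCell c).symm
    · rw [C.unitI_self, C.tgtI_self]
      exact congrArg φ.evalCell (Cell.t_of_lt n.lt_succ_self c)
  map_comp {i} h a b hc hd := by
    rcases (Nat.lt_succ_iff.1 h).eq_or_lt with rfl | hi
    · exact (congrArg φ.evalCell (Cell.comp_top h hc)).trans (φ.evalCell_vcomp a b _ hd)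
    · exact (congrArg φ.evalCell (Cell.comp_of_lt hi h hc)).trans
        (φ.evalCell_hcomp hi a b _ h hd)

theorem extend_compat : NCat.Map.Compat E.truncation f φ.extend where
  src c := (φ.src_evalCell c).symm
  tgt c := (φ.tgt_evalCell c).symm
  unit _ := rfl

end GenMap

/-! ### Extending a lift by one dimension -/

variable {E}

/-- A property of the cells of a free `(n + 1)`-category which holds for attached cells and units
and is closed under compositions holds for all cells. -/
theorem Cell.induction {p : E.Cell → Prop} (gen : ∀ a, p (Cell.mk (.gen a)))
    (unit : ∀ x, p (Cell.unit x)) (vcomp : ∀ a b h, p a → p b → p (Cell.vcomp a b h))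
    (hcomp : ∀ i hi a b h, p a → p b → p (Cell.hcomp i hi a b h)) (c : E.Cell) : p c := by
  obtain ⟨x, y, u, rfl⟩ := c.exists_mk
  induction u with
  | gen a => exact gen a
  | unit x => exact unit x
  | vcomp u v h ihu ihv =>
    rw [← Cell.vcomp_mk u v h]; exact vcomp _ _ _ ihu ihv
  | hcomp i hi u v h h' ihu ihv =>
    rw [← Cell.hcomp_mk hi u v h h']; exact hcomp _ _ _ _ _ ihu ihv

/-- A lift along a trivial fibration of a map extends to a free `(n + 1)`-category. -/
theorem exists_extend {D : OmegaCat.{u}} {g : C ⟶ D}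
    (hg : OmegaCat.trivialFibrations g) {w : A.Map D} {W : E.free.Map D}
    (hW : NCat.Map.Compat E.truncation w W) (f : A.Map C)
    (hf : ∀ x, OmegaCat.Hom.map g (f.map x) = w.map x) :
    ∃ F : E.free.Map C, NCat.Map.Compat E.truncation f F ∧
      ∀ x, OmegaCat.Hom.map g (F.map x) = W.map x := by
  -- The boundary of the image of `a` in `D` is the image under `g` of the parallel pair in `C`,
  -- because `W` is compatible with `w` and `f` lies over `w`.
  have key : ∀ a : E.gen, ∃ c : C.cell (n + 1), C.src c = f.map (E.src a) ∧
      C.tgt c = f.map (E.tgt a) ∧ OmegaCat.Hom.map g c = W.map (Cell.mk (.gen a)) := fun a =>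
    OmegaCat.exists_lift_succ hg (f.parallel fun hi => ⟨E.s_eq hi a, E.t_eq hi a⟩) _
      ((hW.src _).symm.trans (hf _).symm) ((hW.tgt _).symm.trans (hf _).symm)
  choose val hs ht hval using key
  let φ : E.GenMap f := ⟨val, hs, ht⟩
  refine ⟨φ.extend, φ.extend_compat, fun c => ?_⟩
  have hcomp : ∀ (i : ℕ) (hi : i < n + 1) (a b : E.free.cell)
      (h : E.free.t i a = E.free.s i b),
      OmegaCat.Hom.map g (φ.extend.map a) = W.map a →
      OmegaCat.Hom.map g (φ.extend.map b) = W.map b →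
      OmegaCat.Hom.map g (φ.extend.map (E.free.comp i hi a b h)) =
        W.map (E.free.comp i hi a b h) := by
    intro i hi a b h ha hb
    have h₁ := φ.extend.composable hi.le h
    have h₂ := W.composable hi.le h
    rw [φ.extend.map_comp hi a b h h₁, W.map_comp hi a b h h₂,
      OmegaCat.Hom.map_comp g hi _ _ h₁ (by rw [ha, hb, h₂])]
    exact D.comp_congr hi ha hb _ _
  refine Cell.induction (p := fun c => OmegaCat.Hom.map g (φ.extend.map c) = W.map c)
    hval (fun x => ?_) (fun a b h ha hb => ?_) (fun i hi a b h ha hb => ?_) c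
  · exact (OmegaCat.Hom.map_unit g _).trans
      ((congrArg D.unit (hf x)).trans (hW.unit x).symm)
  · have e := Cell.comp_top n.lt_succ_self (Cell.composable_top_iff.2 h)
    rw [← e]
    exact hcomp n n.lt_succ_self a b (Cell.composable_top_iff.2 h) ha hb
  · have e := Cell.comp_of_lt hi (Nat.lt_succ_of_lt hi) ((Cell.composable_iff hi).2 h)
    rw [← e]
    exact hcomp i (Nat.lt_succ_of_lt hi) a b ((Cell.composable_iff hi).2 h) ha hb

end CellExt

/-- The consecutive stages of a polygraph match only up to a propositional equality. With `Q` a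
variable, this equality can be eliminated together with the transport of the truncation. -/
theorem NPolygraph.exists_extend {n : ℕ} {P : NPolygraph.{u} (n + 1)} {Q : NPolygraph.{u} n}
    (h : P.restrict = Q) {C D : OmegaCat.{u}} {g : C ⟶ D} (hg : OmegaCat.trivialFibrations g)
    {w : Q.free.Map D} {W : P.free.Map D}
    (hW : NCat.Map.Compat (P.truncation.cast (congrArg NPolygraph.free h)) w W)
    (f : Q.free.Map C) (hf : ∀ x, OmegaCat.Hom.map g (f.map x) = w.map x) :
    ∃ F : P.free.Map C,
      NCat.Map.Compat (P.truncation.cast (congrArg NPolygraph.free h)) f F ∧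
      ∀ x, OmegaCat.Hom.map g (F.map x) = W.map x := by
  subst h
  exact CellExt.exists_extend (E := P.ext) hg hW f hf

/-! ### Assembling the lifts in all dimensions -/

namespace OmegaCat

variable {X : ∀ n, NCat.{u} n} {T : ∀ n, Truncation (X n) (X (n + 1))} {C : OmegaCat.{u}}

/-- The restriction to the terms of a tower of a morphism from its `∞`-category. -/
def Hom.restrict (v : Hom (ofTower X T) C) (n : ℕ) : (X n).Map C where
  map := v.map (n := n)
  map_s {i} h x := by
    rw [← tower_unitI_srcI X T h x]
    exact (v.map_unitI (n := n) h _).trans (congrArg (C.unitI h) (v.map_srcI (n := n) h x))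
  map_t {i} h x := by
    rw [← tower_unitI_tgtI X T h x]
    exact (v.map_unitI (n := n) h _).trans (congrArg (C.unitI h) (v.map_tgtI (n := n) h x))
  map_comp {i} h x y hc hd :=
    -- Composability in `X n` is an equality of iterated units; injectivity turns it into the
    -- equality of `i`-cells required by the complex.
    have hc' : (towerCells X T).tgtI h.le x = (towerCells X T).srcI h.le y :=
      (ofTower X T).unitI_injective h.le
        ((tower_unitI_tgtI X T h.le x).trans (hc.trans (tower_unitI_srcI X T h.le y).symm))
    v.map_comp h x y hc' hd

theorem Hom.restrict_compat (v : Hom (ofTower X T) C) (n : ℕ) :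
    NCat.Map.Compat (T n) (v.restrict n) (v.restrict (n + 1)) where
  src x := v.map_src (n := n) x
  tgt x := v.map_tgt (n := n) x
  unit x := v.map_unit (n := n) x

/-- The morphism from the `∞`-category of a tower given by compatible maps on its terms. -/
def towerDesc (f : ∀ n, (X n).Map C) (hf : ∀ n, NCat.Map.Compat (T n) (f n) (f (n + 1))) :
    ofTower X T ⟶ C where
  map {n} := (f n).map
  map_src {n} := (hf n).src
  map_tgt {n} := (hf n).tgt
  map_unit {n} := (hf n).unit
  map_comp {n _} h x y _ hd := (f n).map_comp h x y _ hd

end OmegaCat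

theorem Polygraph.exists_lift (S : Polygraph.{u}) {C D : OmegaCat.{u}} {g : C ⟶ D}
    (hg : OmegaCat.trivialFibrations g) (v : S.free ⟶ D) : ∃ l : S.free ⟶ C, l ≫ g = v := by
  let w (n : ℕ) : (S.toNPolygraph n).free.Map D := OmegaCat.Hom.restrict v n
  let L (n : ℕ) : Type u :=
    {f : (S.toNPolygraph n).free.Map C // ∀ x, OmegaCat.Hom.map g (f.map x) = (w n).map x}
  have base : ∃ f : (S.toNPolygraph 0).free.Map C,
      ∀ x, OmegaCat.Hom.map g (f.map x) = (w 0).map x := by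
    choose f hf using fun x => OmegaCat.exists_lift_zero hg ((w 0).map x)
    exact ⟨NCat.Map.ofDiscrete f, hf⟩
  have step (n : ℕ) (f : L n) := NPolygraph.exists_extend (S.restrict_eq n) hg
    (OmegaCat.Hom.restrict_compat v n) f.1 f.2
  choose F hF hgF using step
  let f (n : ℕ) : L n := Nat.rec ⟨base.choose, base.choose_spec⟩ (fun n f => ⟨F n f, hgF n f⟩) n
  -- By definition of the recursion, the lift at stage `n + 1` is the extension chosen for the lift
  -- at stage `n`, hence compatible with it.
  refine ⟨OmegaCat.towerDesc (fun n => (f n).1) fun n => hF n (f n), OmegaCat.Hom.ext ?_⟩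
  funext n x
  exact (f n).2 x

theorem mainTheorem3 (S : Polygraph.{u}) : OmegaCat.IsCofibrant S.free := by
  intro C D g hg
  refine ⟨fun {u v} sq => ?_⟩
  obtain ⟨l, hl⟩ := S.exists_lift hg v
  -- The upper triangle commutes because it starts at the initial complex.
  exact ⟨⟨⟨l, OmegaCat.emptyIsInitial.hom_ext _ _, hl⟩⟩⟩
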